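/- Let $K$ be a number field with ring of integers $\mathcal{O}$, let $b_1,\dots,b_5\in\mathcal{O}$ be such that $f(x)=x^5+b_1x^4+b_2x^3+b_3x^2+b_4x+b_5$ is separable, and let $C$ be the smooth projective curve of genus $2$ over $K$ that is the closure in the weighted projective space $\mathbb{P}_{1,3,1}$ of the smooth affine curve $y^2=f(x)$; it has a unique point $\infty$ outside this affine curve. Let $v$ be a non-archimedean place of $K$ and $K_v$ the completion of $K$ at $v$. Put $\omega_1=\frac{dx}{2y}$, $\omega_2=\frac{x\,dx}{2y}$ and, for a symmetric matrix $c=(c_{ij})_{1\le i,j\le 2}$ over $K_v$, $$\eta_1^{(c)}=(-3x^3-2b_1x^2-b_2x+c_{12}x+c_{11})\frac{dx}{2y},\qquad \eta_2^{(c)}=(-x^2+c_{22}x+c_{12})\frac{dx}{2y}.$$ These are differentials of the second kind on $C$, regular away from $\infty$; write $[\,\cdot\,]$ for classes in the algebraic de Rham cohomology $H^1_{\mathrm{dR}}(C/K_v)$. The cup product on $H^1_{\mathrm{dR}}(C/K_v)$ is regarded as a $K_v$-valued pairing through the trace isomorphism $H^2_{\mathrm{dR}}(C/K_v)\cong K_v$,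 with the sign for which $[\omega]\cup[\eta]=\mathrm{Res}_\infty(\eta\int\omega)$ for differentials of the second kind $\omega,\eta$ that are regular away from $\infty$. Then the map $$c\longmapsto W^{(c)}=\langle[\eta_1^{(c)}],[\eta_2^{(c)}]\rangle$$ is a bijection from the set of symmetric $2\times2$ matrices over $K_v$ to the set of subspaces of $H^1_{\mathrm{dR}}(C/K_v)$ that are complementary to $H^0(C/K_v,\Omega^1)$ and isotropic with respect to the cup product. Moreover, for every such $c$, $[\omega_1],[\omega_2],[-\eta_1^{(c)}],[-\eta_2^{(c)}]$ is a symplectic basis of $H^1_{\mathrm{dR}}(C/K_v)$; that is, it is a basis with $[\omega_i]\cup[\omega_j]=0$, $[\eta_i^{(c)}]\cup[\eta_j^{(c)}]=0$ and $[\omega_i]\cup[-\eta_j^{(c)}]=\delta_{ij}=-\,[-\eta_j^{(c)}]\cup[\omega_i]$. -/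

import Mathlib

/-- The coefficients of an equation `y² = x⁵ + b₁x⁴ + b₂x³ + b₃x² + b₄x + b₅`. Its closure `C` in
the weighted projective space `ℙ(1,3,1)` is the union of two affine charts: `U`, with coordinates
`x, y`, and `V`, with coordinates `u = 1/x, w = y/x³` and equation
`w² = u + b₁u² + b₂u³ + b₃u⁴ + b₄u⁵ + b₅u⁶`. The complement of `U` is the single point `∞`, given by
`u = w = 0`. -/
structure QuinticModel (R : Type*) where
  (b₁ b₂ b₃ b₄ b₅ : R)

namespace QuinticModel

noncomputable section

open Polynomial
open scoped KaehlerDifferential LaurentSeries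

/-- Base change of a model along a ring homomorphism. -/
def map {R S : Type*} [CommRing R] [CommRing S] (φ : R →+* S) (E : QuinticModel R) :
    QuinticModel S :=
  ⟨φ E.b₁, φ E.b₂, φ E.b₃, φ E.b₄, φ E.b₅⟩

/-- The quintic polynomial `x⁵ + b₁x⁴ + b₂x³ + b₃x² + b₄x + b₅`. -/
def poly {R : Type*} [CommRing R] (E : QuinticModel R) : R[X] :=
  X ^ 5 + C E.b₁ * X ^ 4 + C E.b₂ * X ^ 3 + C E.b₃ * X ^ 2 + C E.b₄ * X + C E.b₅

/-- The coordinate ring `k[x, y] / (y² - f(x))` of the affine curve. -/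
abbrev CoordinateRing {k : Type*} [Field k] (E : QuinticModel k) : Type _ :=
  AdjoinRoot (X ^ 2 - C E.poly : k[X][X])

variable {k : Type*} [Field k] (E : QuinticModel k)

theorem natDegree_poly : E.poly.natDegree = 5 := by
  unfold QuinticModel.poly; compute_degree!

theorem irreducible : Irreducible (X ^ 2 - C E.poly : k[X][X]) := by
  have hm : (X ^ 2 - C E.poly : k[X][X]).Monic := monic_X_pow_sub_C _ (by norm_num)
  have hd : (X ^ 2 - C E.poly : k[X][X]).natDegree = 2 := natDegree_X_pow_sub_C
  rw [hm.irreducible_iff_roots_eq_zero_of_degree_le_three (by omega) (by omega)]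
  rw [Multiset.eq_zero_iff_forall_notMem]
  intro r hr
  have h := (mem_roots'.1 hr).2
  have h2 : r ^ 2 = E.poly := by simpa [sub_eq_zero] using h
  have := congrArg natDegree h2
  rw [natDegree_pow, natDegree_poly] at this
  omega

instance : IsDomain E.CoordinateRing := AdjoinRoot.isDomain_of_prime E.irreducible.prime

/-- The function field of the curve, i.e. the fraction field of the coordinate ring. -/
def FunctionField : Type _ := FractionRing E.CoordinateRing

instance : Field E.FunctionField := inferInstanceAs (Field (FractionRing E.CoordinateRing))

instance : Algebra E.CoordinateRing E.FunctionField :=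
  inferInstanceAs (Algebra E.CoordinateRing (FractionRing E.CoordinateRing))

instance : IsFractionRing E.CoordinateRing E.FunctionField :=
  inferInstanceAs (IsFractionRing E.CoordinateRing (FractionRing E.CoordinateRing))

instance : Algebra k E.FunctionField :=
  inferInstanceAs (Algebra k (FractionRing E.CoordinateRing))

instance : IsScalarTower k E.CoordinateRing E.FunctionField :=
  inferInstanceAs (IsScalarTower k E.CoordinateRing (FractionRing E.CoordinateRing))

/-- The coordinate function `x`. -/
def x : E.FunctionField := algebraMap E.CoordinateRing E.FunctionField (AdjoinRoot.of _ X)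

/-- The coordinate function `y`. -/
def y : E.FunctionField := algebraMap E.CoordinateRing E.FunctionField (AdjoinRoot.root _)

/-- The ring of functions on the affine chart `U = C ∖ {∞}`. -/
def ringU : Subalgebra k E.FunctionField := Algebra.adjoin k {E.x, E.y}

/-- The ring of functions on the affine chart `V = {x ≠ 0} ∪ {∞}`, generated by `1/x` and `y/x³`. -/
def ringV : Subalgebra k E.FunctionField := Algebra.adjoin k {E.x⁻¹, E.y / E.x ^ 3}

/-- The ring of functions on `U ∩ V`. -/
def ringUV : Subalgebra k E.FunctionField := Algebra.adjoin k {E.x, E.x⁻¹, E.y}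

/-- The exterior derivative on rational functions, as a `k`-linear map. -/
def d : E.FunctionField →ₗ[k] Ω[E.FunctionField⁄k] :=
  (KaehlerDifferential.D k E.FunctionField).toLinearMap

/-- The image of `Ω[S⁄k]` in the module of rational differentials: the differentials regular on
the affine chart with ring of functions `S`. (For a smooth chart the map is injective.) -/
def regularForms (S : Subalgebra k E.FunctionField) : Submodule k Ω[E.FunctionField⁄k] :=
  Submodule.span k {ω | ∃ a ∈ S, ∃ b ∈ S, ω = a • E.d b}

theorem ringU_le : E.ringU ≤ E.ringUV := Algebra.adjoin_mono (by
  rintro a (rfl | rfl) <;> simp)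

theorem ringV_le : E.ringV ≤ E.ringUV := Algebra.adjoin_le (by
  have h : E.x⁻¹ ∈ E.ringUV := Algebra.subset_adjoin (by simp)
  have h' : E.y ∈ E.ringUV := Algebra.subset_adjoin (by simp)
  rintro a (rfl | rfl)
  · exact h
  · rw [div_eq_mul_inv, ← inv_pow]
    exact mul_mem h' (pow_mem h 3))

theorem d_mem {S : Subalgebra k E.FunctionField} {a : E.FunctionField} (ha : a ∈ S) :
    E.d a ∈ E.regularForms S :=
  Submodule.subset_span ⟨1, one_mem _, a, ha, (one_smul _ _).symm⟩

/-- The 1-cocycles of the total complex of the Čech–de Rham double complex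
`O(U) ⊕ O(V) → Ω(U) ⊕ Ω(V) ⊕ O(U ∩ V) → Ω(U ∩ V)` of the cover `C = U ∪ V`:
triples `(α, β, f)` with `α - β = df` on `U ∩ V`. -/
def cocycles : Submodule k (Ω[E.FunctionField⁄k] × Ω[E.FunctionField⁄k] × E.FunctionField) where
  carrier := {z | z.1 ∈ E.regularForms E.ringU ∧ z.2.1 ∈ E.regularForms E.ringV ∧
    z.2.2 ∈ E.ringUV ∧ z.1 - z.2.1 = E.d z.2.2}
  zero_mem' := ⟨zero_mem _, zero_mem _, zero_mem _, by simp⟩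
  add_mem' := by
    rintro a b ⟨h1, h2, h3, h4⟩ ⟨g1, g2, g3, g4⟩
    refine ⟨add_mem h1 g1, add_mem h2 g2, add_mem h3 g3, ?_⟩
    simp only [Prod.fst_add, Prod.snd_add, map_add, ← h4, ← g4]
    abel
  smul_mem' := by
    rintro c a ⟨h1, h2, h3, h4⟩
    refine ⟨Submodule.smul_mem _ _ h1, Submodule.smul_mem _ _ h2, Subalgebra.smul_mem _ h3 c, ?_⟩
    simp only [Prod.smul_fst, Prod.smul_snd, map_smul, ← h4, smul_sub]

/-- The 1-coboundaries `(dg, dh, g - h)`, for `g ∈ O(U)` and `h ∈ O(V)`. -/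
def coboundaries : Submodule k E.cocycles where
  carrier := {z | ∃ g ∈ E.ringU, ∃ h ∈ E.ringV, z.1 = (E.d g, E.d h, g - h)}
  zero_mem' := ⟨0, zero_mem _, 0, zero_mem _, by simp; rfl⟩
  add_mem' := by
    rintro a b ⟨g, hg, h, hh, e⟩ ⟨g', hg', h', hh', e'⟩
    refine ⟨g + g', add_mem hg hg', h + h', add_mem hh hh', ?_⟩
    rw [Submodule.coe_add, e, e', map_add, map_add, Prod.mk_add_mk, Prod.mk_add_mk,
      add_sub_add_comm]
  smul_mem' := by
    rintro c a ⟨g, hg, h, hh, e⟩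
    refine ⟨c • g, Subalgebra.smul_mem _ hg c, c • h, Subalgebra.smul_mem _ hh c, ?_⟩
    rw [Submodule.coe_smul, e, map_smul, map_smul, Prod.smul_mk, Prod.smul_mk, smul_sub]

/-- The first algebraic de Rham cohomology `H¹_dR(C/k)`, i.e. the first hypercohomology of the
de Rham complex of `C`, computed by the affine open cover `C = U ∪ V`. -/
abbrev H1dR : Type _ := E.cocycles ⧸ E.coboundaries

/-- The space `H⁰(C, Ω¹)` of holomorphic differentials: those regular on both charts. -/
def holomorphicForms : Submodule k Ω[E.FunctionField⁄k] :=
  E.regularForms E.ringU ⊓ E.regularForms E.ringV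

/-- The image of `H⁰(C, Ω¹)` in `H¹_dR(C/k)`: a holomorphic `ω` gives the class of `(ω, ω, 0)`. -/
def holomorphicClasses : Submodule k E.H1dR where
  carrier := {e | ∃ ω ∈ E.holomorphicForms, ∃ z : E.cocycles,
    z.1 = (ω, ω, 0) ∧ E.coboundaries.mkQ z = e}
  zero_mem' := ⟨0, zero_mem _, 0, rfl, map_zero _⟩
  add_mem' := by
    rintro _ _ ⟨ω, hω, z, hz, rfl⟩ ⟨ω', hω', w, hw, rfl⟩
    refine ⟨ω + ω', add_mem hω hω', z + w, ?_, map_add _ _ _⟩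
    rw [Submodule.coe_add, hz, hw, Prod.mk_add_mk, Prod.mk_add_mk, add_zero]
  smul_mem' := by
    rintro c _ ⟨ω, hω, z, hz, rfl⟩
    refine ⟨c • ω, Submodule.smul_mem _ c hω, c • z, ?_, map_smul _ _ _⟩
    rw [Submodule.coe_smul, hz, Prod.smul_mk, Prod.smul_mk, smul_zero]

open Classical in
/-- The de Rham class `[η]` of a differential of the second kind `η` that is regular away from `∞`:
the class of `(η, η - df, f)`, where `f ∈ O(U ∩ V)` is such that `η - df` is regular on `V`.
It does not depend on the choice of `f`: see `dRClass_eq`. -/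
def dRClass (η : Ω[E.FunctionField⁄k]) : E.H1dR :=
  if h : ∃ z : E.cocycles, z.1.1 = η then E.coboundaries.mkQ h.choose else 0

theorem y_sq : E.y ^ 2 = aeval E.x E.poly := by
  have h : (AdjoinRoot.root (X ^ 2 - C E.poly : k[X][X])) ^ 2 =
      AdjoinRoot.of _ E.poly := by
    have := AdjoinRoot.eval₂_root (X ^ 2 - C E.poly : k[X][X])
    simpa [sub_eq_zero] using this
  have h2 := congrArg (algebraMap E.CoordinateRing E.FunctionField) h
  rw [map_pow] at h2
  have hC : (aeval E.x : k[X] →ₐ[k] _) = (IsScalarTower.toAlgHom k E.CoordinateRing _).comp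
      (AdjoinRoot.ofAlgHom k (X ^ 2 - C E.poly : k[X][X])) := by
    ext
    simp [x]
    
  rw [y, h2, hC]
  rfl

section expansion

/-- Selects the coefficientwise `k`-algebra structure on Laurent series. -/
instance laurentAlgebra : Algebra k k⸨X⸩ := HahnSeries.instAlgebra

/-- The substitution `x = t⁻²`. -/
def xHom : k[X] →ₐ[k] k⸨X⸩ := aeval (HahnSeries.single (-2) 1)

theorem xHom_apply (p : k[X]) (n : ℕ) : (xHom p).coeff (-2 * n) = p.coeff n := by
  induction p using Polynomial.induction_on' with
  | add p q hp hq => rw [map_add, HahnSeries.coeff_add, hp, hq, coeff_add]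
  | monomial m a =>
    have : (xHom (monomial m a) : k⸨X⸩) = HahnSeries.single (-2 * m : ℤ) a := by
      rw [xHom, aeval_monomial, HahnSeries.single_pow]
      rw [show (algebraMap k k⸨X⸩ a) = HahnSeries.C a from HahnSeries.algebraMap_apply]
      simp [HahnSeries.C_apply, HahnSeries.single_mul_single, mul_comm]
    rw [this, coeff_monomial, HahnSeries.coeff_single]
    congr 1
    simp [eq_comm]

theorem xHom_injective : Function.Injective (xHom : k[X] →ₐ[k] k⸨X⸩) := by
  intro p q h
  ext n
  rw [← xHom_apply, h, xHom_apply]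

theorem derivative_mul (f g : k⸨X⸩) : LaurentSeries.derivative k (f * g) =
    f * LaurentSeries.derivative k g + g * LaurentSeries.derivative k f := by
  have euler (f : k⸨X⸩) (n : ℤ) :
      (LaurentSeries.derivative k f * HahnSeries.single 1 1).coeff n = n * f.coeff n := by
    rw [HahnSeries.coeff_mul_single, LaurentSeries.derivative_apply, LaurentSeries.hasseDeriv_coeff]
    simp
  have supp (f : k⸨X⸩) : (LaurentSeries.derivative k f * HahnSeries.single 1 1).support ⊆
      f.support := by
    intro n hn hf
    exact hn (by rw [euler, hf, mul_zero])
  have hu : (HahnSeries.single 1 1 : k⸨X⸩) ≠ 0 := by simp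
  apply mul_right_cancel₀ hu
  have e : (f * LaurentSeries.derivative k g + g * LaurentSeries.derivative k f) *
      (HahnSeries.single 1 1 : k⸨X⸩) = f * (LaurentSeries.derivative k g * HahnSeries.single 1 1) +
      (LaurentSeries.derivative k f * HahnSeries.single 1 1) * g := by ring
  rw [e]
  ext n
  rw [euler, HahnSeries.coeff_add, HahnSeries.coeff_mul,
    HahnSeries.coeff_mul_right' g.isPWO_support (supp g),
    HahnSeries.coeff_mul_left' f.isPWO_support (supp f), Finset.mul_sum, ← Finset.sum_add_distrib]
  refine Finset.sum_congr rfl fun ij hij => ?_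
  rw [euler, euler, ← (Finset.mem_antidiagonal.1 hij).2.2]
  push_cast
  ring

/-- The derivation `d/dt` on Laurent series. -/
def ddt : Derivation k k⸨X⸩ k⸨X⸩ :=
  Derivation.mk' (LaurentSeries.derivative k) derivative_mul

theorem ofPowerSeries_coeff_neg (p : PowerSeries k) {n : ℤ} (hn : n < 0) :
    (HahnSeries.ofPowerSeries ℤ k p).coeff n = 0 := by
  rw [HahnSeries.ofPowerSeries_apply, HahnSeries.embDomain_of_notMem_range]
  rintro ⟨m, hm⟩
  simp only [Nat.castOrderEmbedding_apply] at hm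
  omega

theorem exists_ofPowerSeries {f : k⸨X⸩} (hf : ∀ n < 0, f.coeff n = 0) :
    ∃ p, HahnSeries.ofPowerSeries ℤ k p = f := by
  refine ⟨PowerSeries.mk fun n => f.coeff n, ?_⟩
  ext n
  by_cases hn : n < 0
  · rw [ofPowerSeries_coeff_neg _ hn, hf n hn]
  · lift n to ℕ using not_lt.1 hn
    rw [HahnSeries.ofPowerSeries_apply_coeff, PowerSeries.coeff_mk]

theorem d_mul (a b : E.FunctionField) : E.d (a * b) = a • E.d b + b • E.d a :=
  (KaehlerDifferential.D k E.FunctionField).leibniz a b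

theorem d_aeval (a : E.FunctionField) (p : k[X]) :
    E.d (aeval a p) = aeval a (derivative p) • E.d a :=
  (KaehlerDifferential.D k E.FunctionField).map_aeval p a

theorem derivative_ofPowerSeries_coeff_neg (p : PowerSeries k) {n : ℤ} (hn : n < 0) :
    (LaurentSeries.derivative k (HahnSeries.ofPowerSeries ℤ k p)).coeff n = 0 := by
  rw [LaurentSeries.derivative_apply, LaurentSeries.hasseDeriv_coeff]
  rcases eq_or_ne n (-1) with rfl | h
  · simp
  · rw [ofPowerSeries_coeff_neg _ (by push_cast; omega), smul_zero]

theorem xHom_monomial (m : ℕ) (a : k) :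
    (xHom (monomial m a) : k⸨X⸩) = HahnSeries.single (-2 * m : ℤ) a := by
  rw [xHom, aeval_monomial, HahnSeries.single_pow]
  rw [show (algebraMap k k⸨X⸩ a) = HahnSeries.C a from HahnSeries.algebraMap_apply]
  simp [HahnSeries.C_apply, HahnSeries.single_mul_single, mul_comm]

theorem xHom_coeff_pos (p : k[X]) {n : ℤ} (hn : 0 < n) : (xHom p).coeff n = 0 := by
  induction p using Polynomial.induction_on' with
  | add p q hp hq => rw [map_add, HahnSeries.coeff_add, hp, hq, add_zero]
  | monomial m a =>
    rw [xHom_monomial, HahnSeries.coeff_single_of_ne (by omega)]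

theorem exists_of_mem_ringU {a : E.FunctionField} (ha : a ∈ E.ringU) :
    ∃ p q : k[X], a = aeval E.x p + aeval E.x q * E.y := by
  induction ha using Algebra.adjoin_induction with
  | mem a ha =>
    rcases ha with rfl | rfl
    · exact ⟨X, 0, by simp⟩
    · exact ⟨0, 1, by simp⟩
  | algebraMap r => exact ⟨C r, 0, by simp⟩
  | add a b _ _ ha hb =>
    obtain ⟨p, q, rfl⟩ := ha
    obtain ⟨p', q', rfl⟩ := hb
    exact ⟨p + p', q + q', by simp only [map_add]; ring⟩
  | mul a b _ _ ha hb =>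
    obtain ⟨p, q, rfl⟩ := ha
    obtain ⟨p', q', rfl⟩ := hb
    refine ⟨p * p' + q * q' * E.poly, p * q' + q * p', ?_⟩
    simp only [map_add, map_mul, ← y_sq]
    ring

theorem aeval_mem_ringU (p : k[X]) : aeval E.x p ∈ E.ringU :=
  Algebra.adjoin_mono (by simp) (aeval_mem_adjoin_singleton k E.x)

theorem smul_mem_regularForms {S : Subalgebra k E.FunctionField} {a : E.FunctionField} (ha : a ∈ S)
    {ω : Ω[E.FunctionField⁄k]} (hω : ω ∈ E.regularForms S) : a • ω ∈ E.regularForms S := by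
  induction hω using Submodule.span_induction with
  | mem ω h =>
    obtain ⟨b, hb, c, hc, rfl⟩ := h
    exact Submodule.subset_span ⟨a * b, mul_mem ha hb, c, hc, (mul_smul _ _ _).symm⟩
  | zero => rw [smul_zero]; exact zero_mem _
  | add _ _ _ _ h1 h2 => rw [smul_add]; exact add_mem h1 h2
  | smul c ω _ h => rw [smul_comm]; exact Submodule.smul_mem _ c h

variable [CharZero k]

/-- The power series `1 + b₁T + b₂T² + b₃T³ + b₄T⁴ + b₅T⁵`. -/
def revSeries : PowerSeries k :=
  1 + PowerSeries.C E.b₁ * PowerSeries.X + PowerSeries.C E.b₂ * PowerSeries.X ^ 2 +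
    PowerSeries.C E.b₃ * PowerSeries.X ^ 3 + PowerSeries.C E.b₄ * PowerSeries.X ^ 4 +
    PowerSeries.C E.b₅ * PowerSeries.X ^ 5

theorem exists_sqrt : ∃ s : PowerSeries k, s ^ 2 = E.revSeries ∧ PowerSeries.constantCoeff s = 1 := by
  let I : Ideal (PowerSeries k) := .span {PowerSeries.X}
  obtain ⟨a, ha, h1⟩ := HenselianRing.is_henselian (I := I) (X ^ 2 - C E.revSeries)
    (monic_X_pow_sub_C _ (by norm_num)) 1 (by
      simp only [eval_sub, eval_pow, eval_X, eval_C, I, Ideal.mem_span_singleton,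
        PowerSeries.X_dvd_iff]
      simp [revSeries]) (by
      simp only [derivative_sub, derivative_X_pow, derivative_C]
      apply IsUnit.map
      rw [PowerSeries.isUnit_iff_constantCoeff]
      have : PowerSeries.constantCoeff (2 : PowerSeries k) = 2 := map_ofNat _ 2
      simp [this])
  refine ⟨a, by simpa [sub_eq_zero] using ha, ?_⟩
  rw [Ideal.mem_span_singleton, PowerSeries.X_dvd_iff] at h1
  simpa [sub_eq_zero] using h1

/-- The square root of `1 + b₁T + ⋯ + b₅T⁵` with constant term `1`. -/
def sqrtSeries : PowerSeries k := E.exists_sqrt.choose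

/-- The Laurent expansion of `y` at `∞` in the local parameter `t` with `x = t⁻²` and
`y = t⁻⁵ √(1 + b₁t² + b₂t⁴ + b₃t⁶ + b₄t⁸ + b₅t¹⁰)`. -/
def yExpansion : k⸨X⸩ :=
  HahnSeries.single (-5) 1 *
    HahnSeries.ofPowerSeries ℤ k (PowerSeries.expand 2 two_ne_zero E.sqrtSeries)

theorem yExpansion_sq : E.yExpansion ^ 2 =
    aeval (HahnSeries.single (-2) 1 : k⸨X⸩) E.poly := by
  have h : E.sqrtSeries ^ 2 = _ := E.exists_sqrt.choose_spec.1
  have h1 : E.yExpansion ^ 2 = HahnSeries.single (-10) 1 *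
    HahnSeries.ofPowerSeries ℤ k (PowerSeries.expand 2 two_ne_zero (E.sqrtSeries ^ 2)) := by
    rw [yExpansion, mul_pow, map_pow, map_pow, HahnSeries.single_pow]
    norm_num
  have hC (a : k) : (algebraMap k k⸨X⸩ a) = HahnSeries.C a := HahnSeries.algebraMap_apply
  rw [h1, h]
  simp only [revSeries, QuinticModel.poly, map_add, map_mul, map_pow, map_one, PowerSeries.expand_C,
    PowerSeries.expand_X, HahnSeries.ofPowerSeries_C, HahnSeries.ofPowerSeries_X, aeval_X, aeval_C,
    hC, HahnSeries.single_pow, mul_add]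
  simp [HahnSeries.C_apply, HahnSeries.single_mul_single]

/-- The Laurent expansion at `∞` of a regular function on `U`. -/
def coordExpansion : E.CoordinateRing →ₐ[k] k⸨X⸩ :=
  AdjoinRoot.liftAlgHom _ xHom E.yExpansion (by
    simp [E.yExpansion_sq, xHom])

theorem coordExpansion_injective : Function.Injective E.coordExpansion := by
  rw [← AlgHom.coe_toRingHom, RingHom.injective_iff_ker_eq_bot]
  have : Algebra.IsIntegral k[X] E.CoordinateRing := by
    have := (monic_X_pow_sub_C E.poly (two_ne_zero)).finite_adjoinRoot
    infer_instance
  apply Ideal.eq_bot_of_comap_eq_bot (R := k[X])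
  rw [eq_bot_iff]
  intro p hp
  have : xHom p = 0 := by
    have h : E.coordExpansion (AdjoinRoot.of _ p) = 0 := hp
    simpa [coordExpansion] using h
  exact xHom_injective (by simpa using this)

/-- The Laurent expansion of a rational function at `∞`. -/
def expansion : E.FunctionField →ₐ[k] k⸨X⸩ :=
  IsFractionRing.liftAlgHom E.coordExpansion_injective

theorem expansion_x : E.expansion E.x = HahnSeries.single (-2) 1 := by
  rw [expansion, x, IsFractionRing.liftAlgHom_apply, IsFractionRing.lift_algebraMap]
  simp [coordExpansion, xHom]

theorem expansion_y : E.expansion E.y = E.yExpansion := by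
  rw [expansion, y, IsFractionRing.liftAlgHom_apply, IsFractionRing.lift_algebraMap]
  simp [coordExpansion]

/-- The Laurent expansion at `∞` of a rational differential: `a db ↦ a (db/dt)`. -/
def formExpansion : Ω[E.FunctionField⁄k] →ₗ[k] k⸨X⸩ :=
  letI : Algebra E.FunctionField k⸨X⸩ := E.expansion.toRingHom.toAlgebra
  haveI : IsScalarTower k E.FunctionField k⸨X⸩ :=
    IsScalarTower.of_algebraMap_eq' E.expansion.comp_algebraMap.symm
  (ddt.compAlgebraMap E.FunctionField).liftKaehlerDifferential.restrictScalars k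

theorem formExpansion_smul_d (a b : E.FunctionField) : E.formExpansion (a • E.d b) =
    E.expansion a * LaurentSeries.derivative k (E.expansion b) := by
  let _ : Algebra E.FunctionField k⸨X⸩ := E.expansion.toRingHom.toAlgebra
  have _ : IsScalarTower k E.FunctionField k⸨X⸩ :=
    IsScalarTower.of_algebraMap_eq' E.expansion.comp_algebraMap.symm
  change (ddt.compAlgebraMap E.FunctionField).liftKaehlerDifferential
    (a • KaehlerDifferential.D k _ b) = _
  rw [map_smul, Derivation.liftKaehlerDifferential_comp_D]
  rfl

/-- The residue at `∞`. -/
def resInfty : Ω[E.FunctionField⁄k] →ₗ[k] k where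
  toFun ω := (E.formExpansion ω).coeff (-1)
  map_add' _ _ := by rw [map_add, HahnSeries.coeff_add]
  map_smul' _ _ := by rw [map_smul, HahnSeries.coeff_smul, RingHom.id_apply]

theorem resInfty_smul_d (a b : E.FunctionField) : E.resInfty (a • E.d b) =
    (E.expansion a * LaurentSeries.derivative k (E.expansion b)).coeff (-1) := by
  rw [← formExpansion_smul_d]
  rfl

theorem expansion_ringV {a : E.FunctionField} (ha : a ∈ E.ringV) :
    ∃ p, HahnSeries.ofPowerSeries ℤ k p = E.expansion a := by
  have h : E.ringV ≤ ((HahnSeries.ofPowerSeriesAlg ℤ k).range : Subalgebra k k⸨X⸩).comap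
      E.expansion := by
    refine Algebra.adjoin_le ?_
    rintro b (rfl | rfl)
    · refine ⟨PowerSeries.X ^ 2, ?_⟩
      change HahnSeries.ofPowerSeries ℤ k _ = _
      rw [map_pow, HahnSeries.ofPowerSeries_X]
      simp [expansion_x]
    · refine ⟨PowerSeries.X * PowerSeries.expand 2 two_ne_zero E.sqrtSeries, ?_⟩
      change HahnSeries.ofPowerSeries ℤ k _ = E.expansion _
      rw [map_mul, HahnSeries.ofPowerSeries_X, map_div₀, map_pow, expansion_x, expansion_y,
        yExpansion]
      rw [eq_div_iff (by simp), HahnSeries.single_pow, mul_right_comm, HahnSeries.single_mul_single]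
      norm_num
  exact h ha

theorem resInfty_d (a : E.FunctionField) : E.resInfty (E.d a) = 0 := by
  have := E.resInfty_smul_d 1 a
  rw [one_smul, map_one, one_mul] at this
  rw [this, LaurentSeries.derivative_apply, LaurentSeries.hasseDeriv_coeff]
  simp

theorem formExpansion_ringV {ω : Ω[E.FunctionField⁄k]} (hω : ω ∈ E.regularForms E.ringV) {n : ℤ}
    (hn : n < 0) : (E.formExpansion ω).coeff n = 0 := by
  induction hω using Submodule.span_induction with
  | mem ω h =>
    obtain ⟨a, ha, b, hb, rfl⟩ := h
    obtain ⟨p, hp⟩ := E.expansion_ringV ha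
    obtain ⟨q, hq⟩ := E.expansion_ringV hb
    obtain ⟨r, hr⟩ := exists_ofPowerSeries (fun n hn => derivative_ofPowerSeries_coeff_neg q hn)
    rw [formExpansion_smul_d, ← hp, ← hq, ← hr, ← map_mul, ofPowerSeries_coeff_neg _ hn]
  | zero => rw [map_zero, HahnSeries.coeff_zero]
  | add _ _ _ _ h1 h2 => rw [map_add, HahnSeries.coeff_add, h1, h2, add_zero]
  | smul c ω _ h => rw [map_smul, HahnSeries.coeff_smul, h, smul_zero]

theorem resInfty_ringV {ω : Ω[E.FunctionField⁄k]} (hω : ω ∈ E.regularForms E.ringV) :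
    E.resInfty ω = 0 :=
  E.formExpansion_ringV hω (by norm_num)

theorem expansion_aeval (p : k[X]) : E.expansion (aeval E.x p) = xHom p := by
  rw [← aeval_algHom_apply, expansion_x, xHom]

theorem xHom_mul_coeff_odd (p : k[X]) {n : ℤ} (hn : Odd n) :
    (xHom p * HahnSeries.ofPowerSeries ℤ k
      (PowerSeries.expand 2 two_ne_zero E.sqrtSeries)).coeff n = 0 := by
  induction p using Polynomial.induction_on' with
  | add p q hp hq => rw [map_add, add_mul, HahnSeries.coeff_add, hp, hq, add_zero]
  | monomial m a =>
    rw [xHom_monomial, HahnSeries.coeff_single_mul]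
    rcases lt_or_ge (n - -2 * m) 0 with h | h
    · rw [ofPowerSeries_coeff_neg _ h, mul_zero]
    · obtain ⟨j, hj⟩ := Int.eq_ofNat_of_zero_le h
      rw [hj, HahnSeries.ofPowerSeries_apply_coeff, PowerSeries.coeff_expand_of_not_dvd, mul_zero]
      intro hd
      obtain ⟨i, rfl⟩ := hn
      omega

theorem resInfty_smul_dx {a : E.FunctionField} (ha : a ∈ E.ringU) :
    E.resInfty (a • E.d E.x) = 0 := by
  obtain ⟨p, q, rfl⟩ := E.exists_of_mem_ringU ha
  rw [resInfty_smul_d, map_add, map_mul, expansion_aeval, expansion_aeval, expansion_x, expansion_y,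
    yExpansion, LaurentSeries.derivative_apply, LaurentSeries.hasseDeriv_single, add_mul,
    HahnSeries.coeff_add, HahnSeries.coeff_mul_single, xHom_coeff_pos _ (by norm_num),
    mul_left_comm, mul_assoc, HahnSeries.coeff_single_mul, HahnSeries.coeff_mul_single,
    E.xHom_mul_coeff_odd]
  · simp
  · norm_num

theorem resInfty_ringU {ω : Ω[E.FunctionField⁄k]} (hω : ω ∈ E.regularForms E.ringU) :
    E.resInfty ω = 0 := by
  suffices h : ∀ a ∈ E.ringU, ∀ b ∈ E.ringU, E.resInfty (a • E.d b) = 0 by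
    have : E.regularForms E.ringU ≤ LinearMap.ker E.resInfty := by
      refine Submodule.span_le.2 ?_
      rintro _ ⟨a, ha, b, hb, rfl⟩
      exact h a ha b hb
    exact this hω
  intro a ha b hb
  have hy : E.y ∈ E.ringU := Algebra.subset_adjoin (by simp)
  induction hb using Algebra.adjoin_induction generalizing a with
  | mem b hb =>
    rcases hb with rfl | rfl
    · exact E.resInfty_smul_dx ha
    · obtain ⟨p, q, rfl⟩ := E.exists_of_mem_ringU ha
      have h1 : aeval E.x p • E.d E.y = E.d (aeval E.x p * E.y) -
          (E.y * aeval E.x (derivative p)) • E.d E.x := by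
        rw [d_mul, d_aeval, smul_smul]; abel
      have h2 : (2 : k) • ((aeval E.x q * E.y) • E.d E.y) =
          (aeval E.x q * aeval E.x (derivative E.poly)) • E.d E.x := by
        rw [mul_smul _ (aeval E.x (derivative E.poly)), ← d_aeval, ← y_sq, sq, d_mul, mul_smul,
          two_smul, smul_add]
      have h3 : E.resInfty ((aeval E.x q * E.y) • E.d E.y) = 0 := by
        have : (2 : k) * E.resInfty ((aeval E.x q * E.y) • E.d E.y) = 0 := by
          rw [← smul_eq_mul, ← map_smul, h2]
          exact E.resInfty_smul_dx (mul_mem (E.aeval_mem_ringU _) (E.aeval_mem_ringU _))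
        simpa using this
      rw [add_smul, map_add, h3, h1, map_sub, resInfty_d,
        E.resInfty_smul_dx (mul_mem hy (E.aeval_mem_ringU _))]
      simp
  | algebraMap r =>
    have : E.d (algebraMap k _ r) = 0 := (KaehlerDifferential.D k E.FunctionField).map_algebraMap r
    rw [this, smul_zero, map_zero]
  | add b c _ _ hb hc => rw [map_add, smul_add, map_add, hb a ha, hc a ha, add_zero]
  | mul b c hb' hc' hb hc =>
    rw [d_mul, smul_add, map_add, smul_smul, smul_smul, hc _ (mul_mem ha hb'),
      hb _ (mul_mem ha hc'), add_zero]

/-- The cup product of 1-cocycles, `(α, β, f) ∪ (α', β', f') = f β' - f' α ∈ Ω(U ∩ V)`, followed by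
the trace `H²_dR(C/k) = Ω(U ∩ V) / (Ω(U) + Ω(V) + dO(U ∩ V)) → k`, which is the residue at `∞`. -/
def cupCocycle : E.cocycles →ₗ[k] E.cocycles →ₗ[k] k :=
  LinearMap.mk₂ k (fun z w => E.resInfty (z.1.2.2 • w.1.2.1 - w.1.2.2 • z.1.1))
    (fun z z' w => by
      rw [← map_add]; congr 1
      simp only [Submodule.coe_add, Prod.fst_add, Prod.snd_add, add_smul, smul_add]; abel)
    (fun c z w => by
      rw [← map_smul]; congr 1
      simp only [Submodule.coe_smul, Prod.smul_fst, Prod.smul_snd, smul_sub, smul_assoc,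
        smul_comm _ c])
    (fun z w w' => by
      rw [← map_add]; congr 1
      simp only [Submodule.coe_add, Prod.fst_add, Prod.snd_add, add_smul, smul_add]; abel)
    (fun c z w => by
      rw [← map_smul]; congr 1
      simp only [Submodule.coe_smul, Prod.smul_fst, Prod.smul_snd, smul_sub, smul_assoc,
        smul_comm _ c])

theorem resInfty_parts (a b : E.FunctionField) :
    E.resInfty (a • E.d b) = - E.resInfty (b • E.d a) := by
  rw [eq_neg_iff_add_eq_zero, ← map_add, ← d_mul, resInfty_d]

theorem cupCocycle_left {z : E.cocycles} (hz : z ∈ E.coboundaries) (w : E.cocycles) :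
    E.cupCocycle z w = 0 := by
  obtain ⟨g, hg, h, hh, e⟩ := hz
  obtain ⟨w, hU, hV, -, hw⟩ := w
  change E.resInfty (z.1.2.2 • w.2.1 - w.2.2 • z.1.1) = 0
  rw [e, map_sub, sub_smul, map_sub, resInfty_parts, ← hw, smul_sub, map_sub,
    E.resInfty_ringV (E.smul_mem_regularForms hh hV),
    E.resInfty_ringU (E.smul_mem_regularForms hg hU)]
  ring

theorem cupCocycle_right (z : E.cocycles) {w : E.cocycles} (hw : w ∈ E.coboundaries) :
    E.cupCocycle z w = 0 := by
  obtain ⟨g, hg, h, hh, e⟩ := hw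
  obtain ⟨z, hU, hV, -, hz⟩ := z
  change E.resInfty (z.2.2 • w.1.2.1 - w.1.2.2 • z.1) = 0
  rw [e, map_sub, sub_smul, map_sub, resInfty_parts, ← hz, smul_sub, map_sub,
    E.resInfty_ringV (E.smul_mem_regularForms hh hV),
    E.resInfty_ringU (E.smul_mem_regularForms hg hU)]
  ring

/-- The cup product pairing on `H¹_dR(C/k)`, with values in `k = H²_dR(C/k)`. The sign is such that
`[ω] ∪ [η] = Res (η ∫ω)`. -/
def cup : E.H1dR →ₗ[k] E.H1dR →ₗ[k] k :=
  E.coboundaries.liftQ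
    { toFun := fun z => E.coboundaries.liftQ (E.cupCocycle z) (fun _ hw => E.cupCocycle_right z hw)
      map_add' := fun z z' => Submodule.linearMap_qext _
        (LinearMap.ext fun w => LinearMap.map_add₂ E.cupCocycle z z' w)
      map_smul' := fun c z => Submodule.linearMap_qext _
        (LinearMap.ext fun w => LinearMap.map_smul₂ E.cupCocycle c z w) }
    (fun _ hz => LinearMap.mem_ker.2 <| Submodule.linearMap_qext _
      (LinearMap.ext fun w => E.cupCocycle_left hz w))

theorem cup_mkQ (z w : E.cocycles) : E.cup (E.coboundaries.mkQ z) (E.coboundaries.mkQ w) =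
    E.resInfty (z.1.2.2 • w.1.2.1 - w.1.2.2 • z.1.1) := rfl

theorem x_ne_zero : E.x ≠ 0 := by
  intro h
  have := E.expansion_x
  rw [h, map_zero] at this
  simpa using congrArg (fun f => HahnSeries.coeff f (-2)) this

theorem exists_of_mem_ringUV {a : E.FunctionField} (ha : a ∈ E.ringUV) :
    ∃ (N : ℕ) (p q : k[X]), E.x ^ N * a = aeval E.x p + aeval E.x q * E.y := by
  have hx := E.x_ne_zero
  induction ha using Algebra.adjoin_induction with
  | mem a ha =>
    rcases ha with rfl | rfl | rfl
    · exact ⟨0, X, 0, by simp⟩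
    · exact ⟨1, 1, 0, by simp [hx]⟩
    · exact ⟨0, 0, 1, by simp⟩
  | algebraMap r => exact ⟨0, C r, 0, by simp⟩
  | add a b _ _ ha hb =>
    obtain ⟨N, p, q, h⟩ := ha
    obtain ⟨M, p', q', h'⟩ := hb
    refine ⟨N + M, X ^ M * p + X ^ N * p', X ^ M * q + X ^ N * q', ?_⟩
    simp only [map_add, map_mul, map_pow, aeval_X]
    linear_combination E.x ^ M * h + E.x ^ N * h'
  | mul a b _ _ ha hb =>
    obtain ⟨N, p, q, h⟩ := ha
    obtain ⟨M, p', q', h'⟩ := hb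
    refine ⟨N + M, p * p' + q * q' * E.poly, p * q' + q * p', ?_⟩
    simp only [map_add, map_mul, ← y_sq]
    linear_combination E.x ^ M * b * h + (aeval E.x p + aeval E.x q * E.y) * h'

theorem exists_split (N : ℕ) (p : k[X]) : ∃ r ∈ Algebra.adjoin k {E.x⁻¹}, ∃ s : k[X],
    (E.x⁻¹) ^ N * aeval E.x p = r + E.x * aeval E.x s := by
  have hx := E.x_ne_zero
  induction p using Polynomial.induction_on' with
  | add p q hp hq =>
    obtain ⟨r, hr, s, h⟩ := hp
    obtain ⟨r', hr', s', h'⟩ := hq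
    refine ⟨r + r', add_mem hr hr', s + s', ?_⟩
    simp only [map_add]
    linear_combination h + h'
  | monomial m a =>
    rcases le_or_gt m N with h | h
    · refine ⟨algebraMap k _ a * (E.x⁻¹) ^ (N - m), mul_mem (Subalgebra.algebraMap_mem _ a)
        (pow_mem (Algebra.subset_adjoin (by simp)) _), 0, ?_⟩
      obtain ⟨j, rfl⟩ := Nat.exists_eq_add_of_le h
      have hm : (E.x⁻¹) ^ m * E.x ^ m = 1 := by rw [← mul_pow, inv_mul_cancel₀ hx, one_pow]
      rw [aeval_monomial, Nat.add_sub_cancel_left, pow_add, map_zero]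
      linear_combination (E.x⁻¹) ^ j * algebraMap k _ a * hm
    · obtain ⟨j, rfl⟩ := Nat.exists_eq_add_of_lt h
      refine ⟨0, zero_mem _, monomial j a, ?_⟩
      have hm : (E.x⁻¹) ^ N * E.x ^ N = 1 := by rw [← mul_pow, inv_mul_cancel₀ hx, one_pow]
      rw [aeval_monomial, aeval_monomial, pow_add, pow_add, pow_one]
      linear_combination E.x ^ j * E.x * algebraMap k _ a * hm

theorem mem_ringV_of_d_mem {f : E.FunctionField} (hf : f ∈ E.ringUV)
    (hd : E.d f ∈ E.regularForms E.ringV) : f ∈ E.ringV := by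
  have hx := E.x_ne_zero
  have hf0 : ∀ n < 0, (E.expansion f).coeff n = 0 := by
    intro n hn
    have h1 := E.formExpansion_ringV hd (n := n - 1) (by omega)
    rw [← one_smul E.FunctionField (E.d f), formExpansion_smul_d, map_one, one_mul,
      LaurentSeries.derivative_apply, LaurentSeries.hasseDeriv_coeff] at h1
    simpa [hn.ne] using h1
  obtain ⟨N, p, q, h⟩ := E.exists_of_mem_ringUV hf
  obtain ⟨r, hr, s, h1⟩ := E.exists_split N p
  obtain ⟨r', hr', s', h2⟩ := E.exists_split N (X ^ 3 * q)
  have hle : Algebra.adjoin k {E.x⁻¹} ≤ E.ringV := Algebra.adjoin_mono (by simp)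
  have hv : r + r' * (E.y / E.x ^ 3) ∈ E.ringV :=
    add_mem (hle hr) (mul_mem (hle hr') (Algebra.subset_adjoin (by simp)))
  have hsplit : f = r + r' * (E.y / E.x ^ 3) +
      (E.x * aeval E.x s + (E.x ^ 2)⁻¹ * (aeval E.x s' * E.y)) := by
    have hN : (E.x⁻¹) ^ N * E.x ^ N = 1 := by rw [← mul_pow, inv_mul_cancel₀ hx, one_pow]
    have h3 : (E.x⁻¹) ^ N * aeval E.x q = r' / E.x ^ 3 + (E.x ^ 2)⁻¹ * aeval E.x s' := by
      rw [map_mul, map_pow, aeval_X] at h2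
      field_simp
      field_simp at h2
      linear_combination h2
    have h4 : f = (E.x⁻¹) ^ N * aeval E.x p + (E.x⁻¹) ^ N * aeval E.x q * E.y := by
      linear_combination (E.x⁻¹) ^ N * h - f * hN
    rw [h4, h1, h3]
    ring
  obtain ⟨v, hv'⟩ := E.expansion_ringV hv
  have hw : ∀ n < 0, (HahnSeries.single (-2) 1 * xHom s + HahnSeries.single (-1) 1 *
      (xHom s' * HahnSeries.ofPowerSeries ℤ k
        (PowerSeries.expand 2 two_ne_zero E.sqrtSeries)) : k⸨X⸩).coeff n = 0 := by
    intro n hn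
    have h5 := hf0 n hn
    rw [hsplit, map_add, ← hv', HahnSeries.coeff_add, ofPowerSeries_coeff_neg _ hn, zero_add] at h5
    rw [← h5, map_add, map_mul, map_mul, map_mul, map_inv₀, map_pow, expansion_aeval,
      expansion_aeval, expansion_x, expansion_y, yExpansion, HahnSeries.single_pow]
    congr 2
    rw [HahnSeries.inv_single, mul_left_comm (xHom s'),
      ← mul_assoc (HahnSeries.single (-(2 • -2)) _), HahnSeries.single_mul_single]
    norm_num
  have hs : s = 0 := by
    ext n
    have h6 := hw (-2 + -2 * n) (by omega)
    rw [HahnSeries.coeff_add, HahnSeries.coeff_single_mul, HahnSeries.coeff_single_mul,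
      E.xHom_mul_coeff_odd _ ⟨-n - 1, by ring⟩, add_sub_cancel_left, xHom_apply] at h6
    simpa using h6
  have hs' : s' = 0 := by
    obtain ⟨P, hP⟩ := exists_ofPowerSeries hw
    have hu : IsUnit (PowerSeries.expand 2 two_ne_zero E.sqrtSeries) := by
      rw [PowerSeries.isUnit_iff_constantCoeff, PowerSeries.constantCoeff_expand,
        show PowerSeries.constantCoeff E.sqrtSeries = 1 from E.exists_sqrt.choose_spec.2]
      exact isUnit_one
    obtain ⟨T, hT⟩ := hu.exists_right_inv
    have h7 : xHom s' = HahnSeries.ofPowerSeries ℤ k (PowerSeries.X * P * T) := by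
      have h8 : (HahnSeries.single 1 1 : k⸨X⸩) * HahnSeries.single (-1) 1 = 1 := by
        rw [HahnSeries.single_mul_single]
        norm_num
      rw [map_mul, map_mul, hP, hs, map_zero, mul_zero, zero_add, HahnSeries.ofPowerSeries_X,
        ← mul_assoc, h8, one_mul, mul_assoc, ← map_mul, hT, map_one, mul_one]
    ext n
    rw [← xHom_apply, h7, coeff_zero]
    rcases Nat.eq_zero_or_pos n with rfl | hn
    · have := HahnSeries.ofPowerSeries_apply_coeff (Γ := ℤ) (PowerSeries.X * P * T) 0
      simpa using this
    · exact ofPowerSeries_coeff_neg _ (by omega)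
  rw [hsplit, hs, hs']
  simpa using hv

theorem dRClass_eq (z : E.cocycles) : E.dRClass z.1.1 = E.coboundaries.mkQ z := by
  have h : ∃ w : E.cocycles, w.1.1 = z.1.1 := ⟨z, rfl⟩
  rw [dRClass, dif_pos h, ← sub_eq_zero, ← map_sub, Submodule.mkQ_apply,
    Submodule.Quotient.mk_eq_zero]
  have hU : (h.choose - z).1.1 = 0 := sub_eq_zero.2 h.choose_spec
  obtain ⟨-, h2, h3, h4⟩ := (h.choose - z).2
  rw [hU, zero_sub] at h4
  have := E.mem_ringV_of_d_mem h3 (by rw [← h4]; exact neg_mem h2)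
  refine ⟨0, zero_mem _, _, neg_mem this, ?_⟩
  ext1
  · rw [hU, map_zero]
  · ext1
    · rw [map_neg, ← h4, neg_neg]
    · simp

/-- `ω₁ = dx/2y` and `ω₂ = x dx/2y`. -/
def omega : Fin 2 → Ω[E.FunctionField⁄k] :=
  ![(2 * E.y)⁻¹ • E.d E.x, (E.x / (2 * E.y)) • E.d E.x]

/-- `η₁ = (-3x³ - 2b₁x² - b₂x + c₁₂x + c₁₁) dx/2y` and `η₂ = (-x² + c₂₂x + c₁₂) dx/2y`. -/
def eta (c : Matrix (Fin 2) (Fin 2) k) : Fin 2 → Ω[E.FunctionField⁄k] :=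
  ![(aeval E.x (-3 * X ^ 3 - C (2 * E.b₁) * X ^ 2 - C E.b₂ * X + C (c 0 1) * X + C (c 0 0) : k[X]) /
      (2 * E.y)) • E.d E.x,
    (aeval E.x (-X ^ 2 + C (c 1 1) * X + C (c 0 1) : k[X]) / (2 * E.y)) • E.d E.x]

/-- The subspace `W^(c)` of `H¹_dR(C/k)` spanned by the classes of `η₁` and `η₂`. -/
def W (c : Matrix (Fin 2) (Fin 2) k) : Submodule k E.H1dR :=
  Submodule.span k {E.dRClass (E.eta c 0), E.dRClass (E.eta c 1)}

/-- The set of subspaces of `H¹_dR(C/k)` that are complementary to the holomorphic forms and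
isotropic with respect to the cup product. -/
def isotropicComplements : Set (Submodule k E.H1dR) :=
  {W | IsCompl W E.holomorphicClasses ∧ ∀ a ∈ W, ∀ b ∈ W, E.cup a b = 0}

/-- `v₁, v₂, w₁, w₂` is a basis of `H¹_dR(C/k)` in which the cup product has the standard
symplectic Gram matrix. -/
structure IsSymplecticBasis (v w : Fin 2 → E.H1dR) : Prop where
  linearIndependent : LinearIndependent k (Sum.elim v w)
  span_eq_top : Submodule.span k (Set.range (Sum.elim v w)) = ⊤
  cup_left : ∀ i j, E.cup (v i) (v j) = 0
  cup_right : ∀ i j, E.cup (w i) (w j) = 0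
  cup_left_right : ∀ i j, E.cup (v i) (w j) = if i = j then 1 else 0
  cup_right_left : ∀ i j, E.cup (w i) (v j) = if i = j then -1 else 0

end expansion

end

end QuinticModel

instance adicCompletionCharZero (K : Type*) [Field K] [NumberField K]
    (v : IsDedekindDomain.HeightOneSpectrum (NumberField.RingOfIntegers K)) :
    CharZero (v.adicCompletion K) :=
  charZero_of_injective_algebraMap (algebraMap K (v.adicCompletion K)).injective

/-- The base change to the completion `K_v` of a model with coefficients in the ring of integers. -/
noncomputable abbrev QuinticModel.atPlace {K : Type*} [Field K] [NumberField K]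
    (E : QuinticModel (NumberField.RingOfIntegers K))
    (v : IsDedekindDomain.HeightOneSpectrum (NumberField.RingOfIntegers K)) :
    QuinticModel (v.adicCompletion K) :=
  E.map (algebraMap (NumberField.RingOfIntegers K) (v.adicCompletion K))

/-!
Write `f` for the quintic. All forms are written as functions times `ω₁ = dx/2y`, using
`dx = 2y ω₁` and `dy = f'(x) ω₁`. Separability of `f` enters once: on a smooth affine curve
`t² = p(s)` the form `ds/2t` is regular (`inv_smul_d_mem_regularForms`). On the chart at `∞`, with
`u = 1/x` and `w = y/x³`, this is applied to `g(u) = u⁶ f(1/u)`, which is separable as well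
(`separable_polyV`); hence `ω₁ = -u du/2w` and `ω₂ = -du/2w` are holomorphic.

The classes `[ηᵢ]` are represented by explicit cocycles. Subtracting `d(-y/x)` from `η₁`, resp.
`d(-y/x²)` from `η₂` (both for `c = 0`), leaves a polynomial in `1/x` times `ω₁`, which is regular
at `∞`; for general `c` one adds `∑ⱼ cᵢⱼ ωⱼ`. In the cup products of these cocycles the factors `y`
cancel, so that they are residues of Laurent polynomials in `x` times `dx`, and only `dx/x`, of
residue `-2`, contributes. This gives the Gram matrix of `[ωᵢ], [-ηⱼ]` (`cup_omega_eta`,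
`cup_eta_eta`), and with it their linear independence.

That they span (`span_omega_eta`) is a reduction of pole orders: a class is determined by its form
on the affine curve (`dRClass_eq`), forms `xⁿ dx` are exact, and modulo the exact forms
`d(xⁿy) = ((2n + 5) xⁿ⁺⁴ + ⋯) ω₁` a form `p(x) ω₁` reduces to one with `deg p ≤ 3`.

The statement about complements is then linear algebra. A complement of the holomorphic classes,
which are spanned by the `[ωⱼ]` (`holomorphicClasses_eq_span`), has a unique basis of the shape
`[ηᵢ] + ∑ⱼ cᵢⱼ [ωⱼ]`, with `ηᵢ` taken for `c = 0`. The cup product of the `i`-th and the `j`-th of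
these vectors is `cⱼᵢ - cᵢⱼ` (`cup_eta_add`), so the complement is isotropic exactly when `c` is
symmetric.
-/

namespace QuinticModel

open Polynomial
open scoped KaehlerDifferential LaurentSeries

/-! ### Differentials on the affine charts -/

section Forms

variable {k : Type*} [Field k] (E : QuinticModel k)

theorem omega_zero : E.omega 0 = (2 * E.y)⁻¹ • E.d E.x := rfl

theorem smul_omega_zero (a : E.FunctionField) :
    a • E.omega 0 = (a / (2 * E.y)) • E.d E.x := by
  rw [omega_zero, smul_smul, div_eq_mul_inv]

theorem omega_one : E.omega 1 = E.x • E.omega 0 := by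
  rw [omega_zero, smul_smul, ← div_eq_mul_inv]
  rfl

theorem eta_zero (c : Matrix (Fin 2) (Fin 2) k) : E.eta c 0 =
    aeval E.x (-3 * X ^ 3 - C (2 * E.b₁) * X ^ 2 - C E.b₂ * X : k[X]) • E.omega 0 +
      c 0 0 • E.omega 0 + c 0 1 • E.omega 1 := by
  rw [← algebraMap_smul E.FunctionField (c 0 0), ← algebraMap_smul E.FunctionField (c 0 1),
    omega_one, smul_smul, ← add_smul, ← add_smul, smul_omega_zero]
  change (_ / _) • _ = _
  congr 2
  simp only [map_add, map_sub, map_mul, aeval_C, aeval_X]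
  ring

theorem eta_one (c : Matrix (Fin 2) (Fin 2) k) : E.eta c 1 =
    aeval E.x (-X ^ 2 : k[X]) • E.omega 0 + c 0 1 • E.omega 0 + c 1 1 • E.omega 1 := by
  rw [← algebraMap_smul E.FunctionField (c 0 1), ← algebraMap_smul E.FunctionField (c 1 1),
    omega_one, smul_smul, ← add_smul, ← add_smul, smul_omega_zero]
  change (_ / _) • _ = _
  congr 2
  simp only [map_add, map_mul, aeval_C, aeval_X]
  ring

theorem x_mem_ringU : E.x ∈ E.ringU := Algebra.subset_adjoin (by simp)

theorem y_mem_ringU : E.y ∈ E.ringU := Algebra.subset_adjoin (by simp)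

theorem x_inv_mem_ringV : E.x⁻¹ ∈ E.ringV := Algebra.subset_adjoin (by simp)

theorem aeval_x_poly : aeval E.x E.poly = E.x ^ 5 + algebraMap k _ E.b₁ * E.x ^ 4 +
    algebraMap k _ E.b₂ * E.x ^ 3 + algebraMap k _ E.b₃ * E.x ^ 2 + algebraMap k _ E.b₄ * E.x +
    algebraMap k _ E.b₅ := by
  simp [poly]

theorem aeval_x_derivative_poly : aeval E.x (derivative E.poly) = 5 * E.x ^ 4 +
    4 * algebraMap k _ E.b₁ * E.x ^ 3 + 3 * algebraMap k _ E.b₂ * E.x ^ 2 +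
    2 * algebraMap k _ E.b₃ * E.x + algebraMap k _ E.b₄ := by
  simp [poly, map_ofNat]
  ring

theorem d_x_pow (n : ℕ) : E.d (E.x ^ n) = (n * E.x ^ (n - 1)) • E.d E.x := by
  rw [mul_smul, Nat.cast_smul_eq_nsmul]
  exact (KaehlerDifferential.D k E.FunctionField).leibniz_pow E.x n

theorem poly_ne_zero : E.poly ≠ 0 := fun h => by
  simpa [h] using E.natDegree_poly

/-- If `t² = p(s)`, then `2t dt = p'(s) ds`. -/
theorem two_mul_smul_d {s t : E.FunctionField} {p : k[X]} (h : t ^ 2 = aeval s p) :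
    (2 * t) • E.d t = aeval s (derivative p) • E.d s := by
  rw [← d_aeval, ← h, sq, d_mul, two_mul, add_smul]

variable [CharZero k]

theorem functionField_two_ne_zero : (2 : E.FunctionField) ≠ 0 := by
  have h : (algebraMap k E.FunctionField) 2 ≠ 0 := (_root_.map_ne_zero _).2 two_ne_zero
  rwa [map_ofNat] at h

theorem y_ne_zero : E.y ≠ 0 := by
  intro h
  apply E.poly_ne_zero
  apply xHom_injective
  rw [← E.expansion_aeval, ← E.y_sq, h]
  simp

/-- The form `ds/2t` is regular on an affine curve `t² = p(s)` with `p` separable: if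
`a p + b p' = 1`, then `ds/2t = (a(s) t/2) ds + b(s) dt`. -/
theorem inv_smul_d_mem_regularForms {S : Subalgebra k E.FunctionField} {s t : E.FunctionField}
    (hs : s ∈ S) (ht : t ∈ S) (ht0 : t ≠ 0) {p : k[X]} (h : t ^ 2 = aeval s p)
    (hp : p.Separable) : (2 * t)⁻¹ • E.d s ∈ E.regularForms S := by
  obtain ⟨a, b, hab⟩ := hp
  have h2 := E.functionField_two_ne_zero
  have hab' : aeval s a * t ^ 2 + aeval s b * aeval s (derivative p) = 1 := by
    rw [h, ← map_mul, ← map_mul, ← map_add, hab, map_one]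
  have hS (q : k[X]) : aeval s q ∈ S :=
    Algebra.adjoin_le (by simpa using hs) (aeval_mem_adjoin_singleton k s)
  have hd : E.d t = ((2 * t)⁻¹ * aeval s (derivative p)) • E.d s := by
    rw [mul_smul, ← E.two_mul_smul_d h, smul_smul, inv_mul_cancel₀ (mul_ne_zero h2 ht0), one_smul]
  have key : (2 * t)⁻¹ • E.d s =
      (2⁻¹ : k) • ((aeval s a * t) • E.d s) + aeval s b • E.d t := by
    rw [hd, ← algebraMap_smul E.FunctionField (2⁻¹ : k), map_inv₀, map_ofNat, smul_smul, smul_smul,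
      ← add_smul]
    congr 1
    field_simp
    linear_combination - hab'
  rw [key]
  exact add_mem (Submodule.smul_mem _ _ (E.smul_mem_regularForms (mul_mem (hS a) ht) (E.d_mem hs)))
    (E.smul_mem_regularForms (hS b) (E.d_mem ht))

theorem d_x : E.d E.x = (2 * E.y) • E.omega 0 := by
  rw [omega_zero, smul_smul, mul_inv_cancel₀ (mul_ne_zero E.functionField_two_ne_zero E.y_ne_zero),
    one_smul]

theorem d_y : E.d E.y = aeval E.x (derivative E.poly) • E.omega 0 := by
  rw [omega_zero, smul_comm, ← E.two_mul_smul_d E.y_sq, smul_smul,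
    inv_mul_cancel₀ (mul_ne_zero E.functionField_two_ne_zero E.y_ne_zero), one_smul]

theorem d_x_inv : E.d E.x⁻¹ = (-(E.x ^ 2)⁻¹) • E.d E.x := by
  have hx := E.x_ne_zero
  have h : E.x • E.d E.x⁻¹ + E.x⁻¹ • E.d E.x = 0 := by
    rw [← d_mul, mul_inv_cancel₀ hx]
    exact (KaehlerDifferential.D k E.FunctionField).map_one_eq_zero
  have h1 := congrArg (E.x⁻¹ • ·) (eq_neg_of_add_eq_zero_left h)
  simp only [smul_smul, inv_mul_cancel₀ hx, one_smul, smul_neg] at h1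
  rw [h1, neg_smul]
  congr 2
  field_simp

/-- The polynomial `g(u) = u⁶ f(1/u)`, for which `w² = g(u)` is the equation of the chart `V`. -/
noncomputable def polyV : k[X] :=
  X + C E.b₁ * X ^ 2 + C E.b₂ * X ^ 3 + C E.b₃ * X ^ 4 + C E.b₄ * X ^ 5 + C E.b₅ * X ^ 6

theorem y_div_sq : (E.y / E.x ^ 3) ^ 2 = aeval E.x⁻¹ E.polyV := by
  have hx := E.x_ne_zero
  rw [div_pow, E.y_sq, aeval_x_poly]
  simp [polyV]
  field_simp

/-- A common zero `r` of `g` and `g'` is nonzero since `g'(0) = 1`, and then `1/r` is a common zero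
of `f` and `f'`. -/
theorem separable_polyV (h : E.poly.Separable) : E.polyV.Separable := by
  rw [Polynomial.Separable, isCoprime_iff_aeval_ne_zero_of_isAlgClosed k (AlgebraicClosure k)]
    at h ⊢
  intro r
  by_contra! hr
  obtain ⟨h0, h1⟩ := hr
  have hr0 : r ≠ 0 := by
    rintro rfl
    simp [polyV] at h1
  simp only [polyV, map_add, map_mul, map_pow, aeval_X, aeval_C, Polynomial.derivative_mul,
    derivative_C, derivative_X, derivative_X_pow, map_one, map_natCast, zero_mul, zero_add] at h0 h1
  have e0 : aeval r⁻¹ E.poly = 0 := by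
    simp [poly]
    field_simp
    refine mul_left_cancel₀ hr0 ?_
    linear_combination h0
  have e1 : aeval r⁻¹ (derivative E.poly) = 0 := by
    simp [poly, map_ofNat]
    field_simp
    push_cast at h1
    refine mul_left_cancel₀ hr0 ?_
    linear_combination 6 * h0 - r * h1
  rcases h r⁻¹ with h | h
  · exact h e0
  · exact h e1

variable {E}

theorem omega_zero_mem_ringU (h : E.poly.Separable) : E.omega 0 ∈ E.regularForms E.ringU :=
  E.inv_smul_d_mem_regularForms E.x_mem_ringU E.y_mem_ringU E.y_ne_zero E.y_sq h

/-- In the coordinates of `V`, the form `x dx/2y` is `-du/2w`. -/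
theorem omega_one_mem_ringV (h : E.poly.Separable) : E.omega 1 ∈ E.regularForms E.ringV := by
  have hx := E.x_ne_zero
  have hy := E.y_ne_zero
  have h2 := E.functionField_two_ne_zero
  have key : E.omega 1 = -((2 * (E.y / E.x ^ 3))⁻¹ • E.d E.x⁻¹) := by
    rw [omega_one, omega_zero, d_x_inv, smul_smul, smul_smul, ← neg_smul]
    congr 1
    field_simp
  rw [key]
  exact neg_mem (E.inv_smul_d_mem_regularForms E.x_inv_mem_ringV (Algebra.subset_adjoin (by simp))
    (div_ne_zero hy (pow_ne_zero _ hx)) E.y_div_sq (E.separable_polyV h))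

theorem aeval_smul_mem_ringU (h : E.poly.Separable) (p : k[X]) :
    aeval E.x p • E.omega 0 ∈ E.regularForms E.ringU :=
  E.smul_mem_regularForms (E.aeval_mem_ringU p) (omega_zero_mem_ringU h)

theorem aeval_inv_smul_mem_ringV (h : E.poly.Separable) (p : k[X]) :
    aeval E.x⁻¹ p • E.omega 0 ∈ E.regularForms E.ringV := by
  have h0 : E.omega 0 = E.x⁻¹ • E.omega 1 := by
    rw [omega_one, smul_smul, inv_mul_cancel₀ E.x_ne_zero, one_smul]
  have hV : aeval E.x⁻¹ p ∈ E.ringV :=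
    Algebra.adjoin_mono (by simp) (aeval_mem_adjoin_singleton k E.x⁻¹)
  rw [h0, smul_smul]
  exact E.smul_mem_regularForms (mul_mem hV E.x_inv_mem_ringV) (omega_one_mem_ringV h)

variable (E)

/-- Every form regular on `U` is a regular function times `dx/2y`, since `dx = 2y · dx/2y` and
`dy = f'(x) · dx/2y`. -/
theorem exists_smul_omega_zero {ω : Ω[E.FunctionField⁄k]} (hω : ω ∈ E.regularForms E.ringU) :
    ∃ a ∈ E.ringU, ω = a • E.omega 0 := by
  induction hω using Submodule.span_induction with
  | mem ω h =>
    obtain ⟨a, ha, b, hb, rfl⟩ := h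
    obtain ⟨p, q, rfl⟩ := E.exists_of_mem_ringU hb
    refine ⟨a * (aeval E.x (derivative p) * (2 * E.y) + (aeval E.x q *
      aeval E.x (derivative E.poly) + E.y * (aeval E.x (derivative q) * (2 * E.y)))), ?_, ?_⟩
    · have h2 : (2 * E.y) ∈ E.ringU := by
        rw [two_mul]
        exact add_mem E.y_mem_ringU E.y_mem_ringU
      have hp := E.aeval_mem_ringU
      exact mul_mem ha (add_mem (mul_mem (hp _) h2) (add_mem (mul_mem (hp _) (hp _))
        (mul_mem E.y_mem_ringU (mul_mem (hp _) h2))))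
    · rw [map_add, d_mul, d_aeval, d_aeval, d_y, d_x]
      simp only [mul_smul, add_smul]
  | zero => exact ⟨0, zero_mem _, (zero_smul _ _).symm⟩
  | add _ _ _ _ h1 h2 =>
    obtain ⟨a, ha, rfl⟩ := h1
    obtain ⟨b, hb, rfl⟩ := h2
    exact ⟨a + b, add_mem ha hb, (add_smul _ _ _).symm⟩
  | smul c _ _ h =>
    obtain ⟨a, ha, rfl⟩ := h
    exact ⟨c • a, Subalgebra.smul_mem _ ha c, (smul_assoc _ _ _).symm⟩

/-- For `n = 0` the last term, where `n - 1` is truncated, has coefficient zero. -/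
theorem d_pow_mul_y (n : ℕ) : E.d (E.x ^ n * E.y) =
    ((2 * n + 5) * E.x ^ (n + 4) + (2 * n + 4) * algebraMap k _ E.b₁ * E.x ^ (n + 3) +
      (2 * n + 3) * algebraMap k _ E.b₂ * E.x ^ (n + 2) +
      (2 * n + 2) * algebraMap k _ E.b₃ * E.x ^ (n + 1) +
      (2 * n + 1) * algebraMap k _ E.b₄ * E.x ^ n +
      2 * n * algebraMap k _ E.b₅ * E.x ^ (n - 1)) • E.omega 0 := by
  have h := E.d_x_pow n
  have hy := E.y_sq
  rw [d_mul, h, d_y, d_x, smul_smul, smul_smul, smul_smul, ← add_smul, aeval_x_derivative_poly]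
  rw [aeval_x_poly] at hy
  congr 1
  cases n with
  | zero => push_cast; ring
  | succ n =>
    rw [Nat.add_sub_cancel]
    push_cast
    linear_combination 2 * (n + 1) * E.x ^ n * hy

end Forms

/-! ### Residues and the cup product -/

section Residues

variable {k : Type*} [Field k] [CharZero k] (E : QuinticModel k)

theorem resInfty_zpow_smul_d (n : ℤ) :
    E.resInfty (E.x ^ n • E.d E.x) = if n = -1 then -2 else 0 := by
  have h : (HahnSeries.single (-2) 1 : k⸨X⸩) ^ n = HahnSeries.single (-2 * n) 1 := by
    rw [RatFunc.single_zpow (-2 * n), RatFunc.single_zpow (-2), zpow_mul]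
  rw [resInfty_smul_d, map_zpow₀, expansion_x, h,
    LaurentSeries.derivative_apply, LaurentSeries.hasseDeriv_single, HahnSeries.single_mul_single,
    HahnSeries.coeff_single]
  by_cases hn : n = -1
  · simp [hn]
  · rw [if_neg hn, if_neg (by simp; omega)]

theorem resInfty_zpow_mul_y_smul (a : k) (n : ℤ) :
    E.resInfty ((algebraMap k _ a * E.x ^ n * E.y) • E.omega 0) = if n = -1 then -a else 0 := by
  have h : (algebraMap k _ a * E.x ^ n * E.y) • E.omega 0 = (a / 2) • (E.x ^ n • E.d E.x) := by
    have h2 := E.functionField_two_ne_zero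
    rw [d_x, ← algebraMap_smul E.FunctionField (a / 2), smul_smul, smul_smul, map_div₀, map_ofNat]
    congr 1
    field_simp
  rw [h, map_smul, resInfty_zpow_smul_d, smul_ite]
  simp

/-- The residue of the exact form `-d(ff')` is `a ∪ b + b ∪ a`, where `f` and `f'` are the functions
in cocycles representing `a` and `b`. -/
theorem cup_antisymm (a b : E.H1dR) : E.cup a b = -E.cup b a := by
  obtain ⟨z, rfl⟩ := E.coboundaries.mkQ_surjective a
  obtain ⟨w, rfl⟩ := E.coboundaries.mkQ_surjective b
  obtain ⟨-, -, -, hz⟩ := z.2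
  obtain ⟨-, -, -, hw⟩ := w.2
  have h := E.resInfty_d (z.1.2.2 * w.1.2.2)
  rw [d_mul, ← hz, ← hw] at h
  simp only [cup_mkQ, smul_sub, map_add, map_sub] at h ⊢
  linear_combination -h

theorem cup_self (a : E.H1dR) : E.cup a a = 0 := self_eq_neg.1 (E.cup_antisymm a a)

end Residues

/-! ### A basis of de Rham cohomology -/

section Cocycles

variable {k : Type*} [Field k] [CharZero k] {E : QuinticModel k}

theorem omega_mem_ringU (h : E.poly.Separable) (i : Fin 2) :
    E.omega i ∈ E.regularForms E.ringU := by
  fin_cases i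
  · exact omega_zero_mem_ringU h
  · simpa [omega_one] using aeval_smul_mem_ringU h X

theorem omega_mem_ringV (h : E.poly.Separable) (i : Fin 2) :
    E.omega i ∈ E.regularForms E.ringV := by
  fin_cases i
  · simpa using aeval_inv_smul_mem_ringV h 1
  · exact omega_one_mem_ringV h

/-- The cocycle `(ωᵢ, ωᵢ, 0)`. -/
noncomputable def omegaCocycle (h : E.poly.Separable) (i : Fin 2) : E.cocycles :=
  ⟨(E.omega i, E.omega i, 0), omega_mem_ringU h i, omega_mem_ringV h i, zero_mem _, by simp⟩

theorem d_y_mul_x_inv : E.d (E.y * E.x⁻¹) =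
    (3 * E.x ^ 3 + 2 * algebraMap k _ E.b₁ * E.x ^ 2 + algebraMap k _ E.b₂ * E.x -
      algebraMap k _ E.b₄ * E.x⁻¹ - 2 * algebraMap k _ E.b₅ * E.x⁻¹ ^ 2) • E.omega 0 := by
  have hx := E.x_ne_zero
  have hy := E.y_sq
  rw [aeval_x_poly] at hy
  rw [d_mul, d_x_inv, d_y, d_x, smul_smul, smul_smul, smul_smul, ← add_smul,
    aeval_x_derivative_poly]
  congr 1
  field_simp
  linear_combination -2 * hy

theorem d_y_mul_x_inv_sq : E.d (E.y * E.x⁻¹ * E.x⁻¹) =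
    (E.x ^ 2 - algebraMap k _ E.b₂ - 2 * algebraMap k _ E.b₃ * E.x⁻¹ -
      3 * algebraMap k _ E.b₄ * E.x⁻¹ ^ 2 - 4 * algebraMap k _ E.b₅ * E.x⁻¹ ^ 3) • E.omega 0 := by
  have hx := E.x_ne_zero
  have hy := E.y_sq
  rw [aeval_x_poly] at hy
  rw [d_mul, d_y_mul_x_inv, d_x_inv, d_x, smul_smul, smul_smul, smul_smul, ← add_smul]
  congr 1
  field_simp
  linear_combination -2 * hy

/-- The cocycle `(η₁, η₁ + d(y/x), -y/x)` for `η₁` with `c = 0`. -/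
noncomputable def etaCocycleZero (h : E.poly.Separable) : E.cocycles :=
  ⟨(aeval E.x (-3 * X ^ 3 - C (2 * E.b₁) * X ^ 2 - C E.b₂ * X : k[X]) • E.omega 0,
    aeval E.x⁻¹ (-(C E.b₄ * X) - C (2 * E.b₅) * X ^ 2 : k[X]) • E.omega 0,
    -(E.y * E.x⁻¹)), aeval_smul_mem_ringU h _, aeval_inv_smul_mem_ringV h _,
    neg_mem (mul_mem (Algebra.subset_adjoin (by simp)) (Algebra.subset_adjoin (by simp))), by
      rw [map_neg, d_y_mul_x_inv, ← sub_smul, ← neg_smul]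
      congr 1
      simp [map_ofNat]
      ring⟩

/-- The cocycle `(η₂, η₂ + d(y/x²), -y/x²)` for `η₂` with `c = 0`. -/
noncomputable def etaCocycleOne (h : E.poly.Separable) : E.cocycles :=
  ⟨(aeval E.x (-X ^ 2 : k[X]) • E.omega 0,
    aeval E.x⁻¹ (-C E.b₂ - C (2 * E.b₃) * X - C (3 * E.b₄) * X ^ 2 - C (4 * E.b₅) * X ^ 3 : k[X]) •
      E.omega 0,
    -(E.y * E.x⁻¹ * E.x⁻¹)), aeval_smul_mem_ringU h _, aeval_inv_smul_mem_ringV h _,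
    neg_mem (mul_mem (mul_mem (Algebra.subset_adjoin (by simp)) (Algebra.subset_adjoin (by simp)))
      (Algebra.subset_adjoin (by simp))), by
      rw [map_neg E.d, d_y_mul_x_inv_sq, ← sub_smul, ← neg_smul]
      congr 1
      simp [map_ofNat]
      ring⟩

/-- The classes of `ω₁` and `ω₂`. -/
noncomputable def omegaClass (h : E.poly.Separable) (i : Fin 2) : E.H1dR :=
  E.coboundaries.mkQ (omegaCocycle h i)

/-- The classes of `η₁` and `η₂` for the matrix `c = 0`. -/
noncomputable def etaClass (h : E.poly.Separable) : Fin 2 → E.H1dR :=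
  ![E.coboundaries.mkQ (etaCocycleZero h), E.coboundaries.mkQ (etaCocycleOne h)]

theorem dRClass_omega (h : E.poly.Separable) (i : Fin 2) :
    E.dRClass (E.omega i) = omegaClass h i :=
  E.dRClass_eq (omegaCocycle h i)

theorem dRClass_neg (z : E.cocycles) : E.dRClass (-z.1.1) = -E.dRClass z.1.1 := by
  rw [dRClass_eq, ← map_neg]
  exact E.dRClass_eq (-z)

/-- Symmetry of `c` is needed since both `η₁` and `η₂` are written with the entry `c₁₂`. -/
theorem exists_cocycle_eta (h : E.poly.Separable) {c : Matrix (Fin 2) (Fin 2) k} (hc : c.IsSymm)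
    (i : Fin 2) : ∃ z : E.cocycles, z.1.1 = E.eta c i ∧
      E.coboundaries.mkQ z = etaClass h i + ∑ j, c i j • omegaClass h j := by
  have h10 := hc.apply 0 1
  fin_cases i
  · refine ⟨etaCocycleZero h + c 0 0 • omegaCocycle h 0 + c 0 1 • omegaCocycle h 1,
      (E.eta_zero c).symm, ?_⟩
    rw [map_add, map_add, map_smul, map_smul, Fin.sum_univ_two, ← add_assoc]
    rfl
  · refine ⟨etaCocycleOne h + c 0 1 • omegaCocycle h 0 + c 1 1 • omegaCocycle h 1,
      (E.eta_one c).symm, ?_⟩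
    rw [map_add, map_add, map_smul, map_smul, Fin.sum_univ_two, ← add_assoc, ← h10]
    rfl

theorem cup_omega_omega (h : E.poly.Separable) (i j : Fin 2) :
    E.cup (omegaClass h i) (omegaClass h j) = 0 := by
  rw [omegaClass, omegaClass, cup_mkQ]
  simp [omegaCocycle]

theorem cup_omega_eta (h : E.poly.Separable) (i j : Fin 2) :
    E.cup (omegaClass h i) (etaClass h j) = if i = j then -1 else 0 := by
  have hx := E.x_ne_zero
  have key (a : E.FunctionField) (n : ℤ) (ha : a = -(E.x ^ n * E.y)) :
      E.resInfty (-(a • E.omega 0)) = if n = -1 then -1 else 0 := by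
    rw [← E.resInfty_zpow_mul_y_smul 1 n, ha, ← neg_smul, neg_neg, map_one, one_mul]
  fin_cases i <;> fin_cases j <;>
    simp only [omegaClass, etaClass, Matrix.cons_val, cup_mkQ, omegaCocycle, etaCocycleZero,
      etaCocycleOne, omega_one, smul_smul, zero_mul, zero_smul, zero_sub, Fin.zero_eta, Fin.mk_one]
  · rw [key _ (-1) (by simp; ring)]; simp
  · rw [key _ (-2) (by field_simp)]; simp
  · rw [key _ 0 (by field_simp)]; simp
  · rw [key _ (-1) (by field_simp)]; simp

/-- Both terms of the cup product have residue `-b₂`. -/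
theorem cup_eta_eta (h : E.poly.Separable) (i j : Fin 2) :
    E.cup (etaClass h i) (etaClass h j) = 0 := by
  have key : E.cup (etaClass h 0) (etaClass h 1) = 0 := by
    have hx := E.x_ne_zero
    have e := E.resInfty_zpow_mul_y_smul
    have h0 : (etaCocycleZero h).1.2.2 • (etaCocycleOne h).1.2.1 -
        (etaCocycleOne h).1.2.2 • (etaCocycleZero h).1.1 =
        (algebraMap k _ (2 * E.b₃) * E.x ^ (-2 : ℤ) * E.y) • E.omega 0 +
        (algebraMap k _ (3 * E.b₄) * E.x ^ (-3 : ℤ) * E.y) • E.omega 0 +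
        (algebraMap k _ (4 * E.b₅) * E.x ^ (-4 : ℤ) * E.y) • E.omega 0 -
        (algebraMap k _ 3 * E.x ^ (1 : ℤ) * E.y) • E.omega 0 -
        (algebraMap k _ (2 * E.b₁) * E.x ^ (0 : ℤ) * E.y) • E.omega 0 := by
      simp only [etaCocycleZero, etaCocycleOne, smul_smul, ← sub_smul, ← add_smul]
      congr 1
      simp [map_ofNat]
      field_simp
      ring
    change E.cup (E.coboundaries.mkQ _) (E.coboundaries.mkQ _) = 0
    rw [cup_mkQ, h0, map_sub, map_sub, map_add, map_add, e, e, e, e, e]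
    simp
  fin_cases i <;> fin_cases j
  · exact E.cup_self _
  · exact key
  · exact (E.cup_antisymm _ _).trans (neg_eq_zero.2 key)
  · exact E.cup_self _

/-- Modulo the forms `d(xⁿy)`, whose leading terms are `(2n + 5) xⁿ⁺⁴ dx/2y`, every form regular
on `U` reduces to `p(x) dx/2y` with `deg p ≤ 3`; and a class is determined by its form on `U`. -/
theorem span_omega_eta (h : E.poly.Separable) :
    Submodule.span k (Set.range (Sum.elim (omegaClass h) (etaClass h))) = ⊤ := by
  set S := Submodule.span k (Set.range (Sum.elim (omegaClass h) (etaClass h))) with hS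
  -- The forms on `U` that are the first component of a cocycle with class in `S`.
  let N : Submodule k Ω[E.FunctionField⁄k] :=
    (S.comap E.coboundaries.mkQ).map ((LinearMap.fst k _ _).comp E.cocycles.subtype)
  have hN (z : E.cocycles) (hz : E.coboundaries.mkQ z ∈ S) : z.1.1 ∈ N := ⟨z, hz, rfl⟩
  have hω (i : Fin 2) : E.omega i ∈ N :=
    hN (omegaCocycle h i) (Submodule.subset_span ⟨Sum.inl i, rfl⟩)
  have hd {g : E.FunctionField} (hg : g ∈ E.ringU) : E.d g ∈ N := by
    refine hN ⟨(E.d g, 0, g), E.d_mem hg, zero_mem _, E.ringU_le hg, sub_zero _⟩ ?_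
    convert zero_mem S
    rw [Submodule.mkQ_apply, Submodule.Quotient.mk_eq_zero]
    exact ⟨g, hg, 0, zero_mem _, by simp⟩
  have hpow (n : ℕ) : E.x ^ n • E.omega 0 ∈ N := by
    have hmul (a : k) (b : E.FunctionField) (hb : b • E.omega 0 ∈ N) :
        (algebraMap k _ a * b) • E.omega 0 ∈ N := by
      rw [mul_smul, algebraMap_smul]
      exact N.smul_mem a hb
    have hdiv (a : k) (ha : a ≠ 0) (b : E.FunctionField)
        (hb : (algebraMap k _ a * b) • E.omega 0 ∈ N) : b • E.omega 0 ∈ N := by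
      rwa [mul_smul, algebraMap_smul, N.smul_mem_iff ha] at hb
    induction n using Nat.strong_induction_on with
    | _ n ih =>
      rcases n with _ | _ | _ | _ | n
      · simpa using hω 0
      · simpa [omega_one] using hω 1
      · have := hN (etaCocycleOne h) (Submodule.subset_span ⟨Sum.inr 1, rfl⟩)
        simpa [etaCocycleOne] using this
      · have h3 := hN (etaCocycleZero h) (Submodule.subset_span ⟨Sum.inr 0, rfl⟩)
        have h2 := hmul (2 * E.b₁) _ (ih 2 (by omega))
        have h1 := hmul E.b₂ _ (ih 1 (by omega))
        refine hdiv 3 three_ne_zero _ ?_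
        convert neg_mem (add_mem (add_mem h3 h2) h1) using 1
        simp only [etaCocycleZero, ← add_smul, ← neg_smul]
        congr 1
        simp [map_ofNat]
        ring
      · have h3 := hmul ((2 * n + 4) * E.b₁) _ (ih (n + 3) (by omega))
        have h2 := hmul ((2 * n + 3) * E.b₂) _ (ih (n + 2) (by omega))
        have h1 := hmul ((2 * n + 2) * E.b₃) _ (ih (n + 1) (by omega))
        have h0 := hmul ((2 * n + 1) * E.b₄) _ (ih n (by omega))
        have h' := hmul (2 * n * E.b₅) _ (ih (n - 1) (by omega))
        have hy := hd (mul_mem (pow_mem E.x_mem_ringU n) E.y_mem_ringU)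
        rw [d_pow_mul_y] at hy
        refine hdiv (2 * n + 5) (by exact_mod_cast (by omega : 2 * n + 5 ≠ 0)) _ ?_
        convert sub_mem hy (add_mem (add_mem (add_mem (add_mem h3 h2) h1) h0) h') using 1
        simp only [← add_smul, ← sub_smul]
        congr 1
        simp [map_ofNat]
  have hpow' (n : ℕ) : (E.x ^ n * E.y) • E.omega 0 ∈ N := by
    have h1 := hd (pow_mem E.x_mem_ringU (n + 1))
    have e : E.d (E.x ^ (n + 1)) = (2 * (n + 1) : k) • ((E.x ^ n * E.y) • E.omega 0) := by
      rw [d_x_pow, d_x, ← algebraMap_smul E.FunctionField (2 * (n + 1) : k), smul_smul, smul_smul]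
      congr 1
      simp [map_ofNat]
      ring
    rwa [e, N.smul_mem_iff (by exact_mod_cast (by omega : 2 * (n + 1) ≠ 0))] at h1
  have hU {ω : Ω[E.FunctionField⁄k]} (hω : ω ∈ E.regularForms E.ringU) : ω ∈ N := by
    obtain ⟨a, ha, rfl⟩ := E.exists_smul_omega_zero hω
    obtain ⟨p, q, rfl⟩ := E.exists_of_mem_ringU ha
    rw [add_smul]
    refine add_mem ?_ ?_
    · rw [aeval_eq_sum_range, Finset.sum_smul]
      exact sum_mem fun i _ => by
        rw [smul_assoc]
        exact N.smul_mem _ (hpow i)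
    · rw [aeval_eq_sum_range, Finset.sum_mul, Finset.sum_smul]
      exact sum_mem fun i _ => by
        rw [smul_mul_assoc, smul_assoc]
        exact N.smul_mem _ (hpow' i)
  refine (Submodule.eq_top_iff'.2 fun a => ?_)
  obtain ⟨z, rfl⟩ := E.coboundaries.mkQ_surjective a
  obtain ⟨w, hw, hwz⟩ := hU z.2.1
  have hwz' : w.1.1 = z.1.1 := hwz
  rw [← E.dRClass_eq z, ← hwz', E.dRClass_eq w]
  exact hw

end Cocycles

/-! ### Symplectic bases and isotropic complements -/

theorem map_poly {R S : Type*} [CommRing R] [CommRing S] (φ : R →+* S) (E : QuinticModel R) :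
    (E.map φ).poly = E.poly.map φ := by
  simp [poly, map]

section Symplectic

variable {k : Type*} [Field k] {E : QuinticModel k}

theorem dRClass_eta_mem_W (c : Matrix (Fin 2) (Fin 2) k) (i : Fin 2) :
    E.dRClass (E.eta c i) ∈ E.W c := by
  fin_cases i <;> exact Submodule.subset_span (by simp)

variable [CharZero k]

/-- Pairing a linear relation with the `vᵢ` and the `wᵢ` gives its coefficients. -/
theorem linearIndependent_of_cup {v w : Fin 2 → E.H1dR} (hv : ∀ i j, E.cup (v i) (v j) = 0)
    (hw : ∀ i j, E.cup (w i) (w j) = 0)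
    (hvw : ∀ i j, E.cup (v i) (w j) = if i = j then 1 else 0) :
    LinearIndependent k (Sum.elim v w) := by
  rw [Fintype.linearIndependent_iff]
  intro g hg
  have hwv (i j) : E.cup (w i) (v j) = if j = i then -1 else 0 := by
    rw [cup_antisymm, hvw]
    split_ifs <;> simp
  simp only [Fintype.sum_sum_type, Sum.elim_inl, Sum.elim_inr] at hg
  rintro (i | i)
  · simpa [hw, hwv, -Fin.sum_univ_two] using congrArg (E.cup (w i)) hg
  · simpa [hv, hvw, -Fin.sum_univ_two] using congrArg (E.cup (v i)) hg

theorem IsSymplecticBasis.isCompl {v w : Fin 2 → E.H1dR} (h : E.IsSymplecticBasis v w) :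
    IsCompl (Submodule.span k (Set.range v)) (Submodule.span k (Set.range w)) := by
  refine ⟨(linearIndependent_sum.1 h.linearIndependent).2.2, codisjoint_iff.2 ?_⟩
  simpa [Submodule.span_union, Set.Sum.elim_range] using h.span_eq_top

theorem dRClass_eta (h : E.poly.Separable) {c : Matrix (Fin 2) (Fin 2) k} (hc : c.IsSymm)
    (i : Fin 2) : E.dRClass (E.eta c i) = etaClass h i + ∑ j, c i j • omegaClass h j := by
  obtain ⟨z, hz, e⟩ := exists_cocycle_eta h hc i
  rw [← hz, dRClass_eq, e]

theorem dRClass_neg_eta (h : E.poly.Separable) {c : Matrix (Fin 2) (Fin 2) k} (hc : c.IsSymm)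
    (i : Fin 2) : E.dRClass (-E.eta c i) = -E.dRClass (E.eta c i) := by
  obtain ⟨z, hz, -⟩ := exists_cocycle_eta h hc i
  rw [← hz, dRClass_neg]

theorem cup_eta_omega (h : E.poly.Separable) (i j : Fin 2) :
    E.cup (etaClass h i) (omegaClass h j) = if i = j then 1 else 0 := by
  rw [cup_antisymm, cup_omega_eta]
  simp only [eq_comm (a := j)]
  split_ifs <;> simp

/-- The span of the vectors `[ηᵢ] + ∑ⱼ cᵢⱼ [ωⱼ]` is isotropic exactly when `c` is symmetric. -/
theorem cup_eta_add (h : E.poly.Separable) (c : Fin 2 → Fin 2 → k) (i j : Fin 2) :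
    E.cup (etaClass h i + ∑ l, c i l • omegaClass h l)
      (etaClass h j + ∑ l, c j l • omegaClass h l) = c j i - c i j := by
  simp [cup_omega_omega, cup_omega_eta, cup_eta_eta, cup_eta_omega, -Fin.sum_univ_two]
  ring

theorem isSymplecticBasis (h : E.poly.Separable) {c : Matrix (Fin 2) (Fin 2) k} (hc : c.IsSymm) :
    E.IsSymplecticBasis (fun i => E.dRClass (E.omega i)) (fun i => E.dRClass (-E.eta c i)) := by
  have hωω := cup_omega_omega h
  have hωη := cup_omega_eta h
  have hv (i j) : E.cup (E.dRClass (E.omega i)) (E.dRClass (E.omega j)) = 0 := by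
    rw [dRClass_omega h, dRClass_omega h, hωω]
  have hw (i j) : E.cup (E.dRClass (-E.eta c i)) (E.dRClass (-E.eta c j)) = 0 := by
    rw [dRClass_neg_eta h hc, dRClass_neg_eta h hc, dRClass_eta h hc, dRClass_eta h hc,
      map_neg, LinearMap.map_neg₂, neg_neg]
    exact (cup_eta_add h c i j).trans (sub_eq_zero.2 (hc.apply i j))
  have hvw (i j) : E.cup (E.dRClass (E.omega i)) (E.dRClass (-E.eta c j)) =
      if i = j then 1 else 0 := by
    rw [dRClass_neg_eta h hc, dRClass_eta h hc, dRClass_omega h]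
    simp only [map_neg, map_add, hωη, map_sum, map_smul, hωω]
    split_ifs <;> simp
  refine ⟨linearIndependent_of_cup hv hw hvw, ?_, hv, hw, hvw, fun i j => ?_⟩
  · rw [eq_top_iff, ← span_omega_eta h, Submodule.span_le]
    have hω (i) : omegaClass h i ∈ Submodule.span k (Set.range (Sum.elim
        (fun i => E.dRClass (E.omega i)) (fun i => E.dRClass (-E.eta c i)))) :=
      Submodule.subset_span ⟨Sum.inl i, dRClass_omega h i⟩
    rintro _ ⟨i | i, rfl⟩
    · exact hω i
    · have e : etaClass h i = -E.dRClass (-E.eta c i) - ∑ j, c i j • omegaClass h j := by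
        rw [dRClass_neg_eta h hc, dRClass_eta h hc]
        abel
      rw [Sum.elim_inr, e]
      exact sub_mem (neg_mem (Submodule.subset_span ⟨Sum.inr i, rfl⟩))
        (sum_mem fun j _ => Submodule.smul_mem _ _ (hω j))
  · rw [cup_antisymm, hvw]
    simp only [eq_comm (a := j)]
    split_ifs <;> simp

/-- Holomorphic classes are orthogonal to `[ω₁]` and `[ω₂]`, hence have no `η`-component. -/
theorem holomorphicClasses_eq_span (h : E.poly.Separable) :
    E.holomorphicClasses = Submodule.span k (Set.range (omegaClass h)) := by
  apply le_antisymm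
  · rintro a ⟨ω, -, z, hz, rfl⟩
    have horth (i) : E.cup (omegaClass h i) (E.coboundaries.mkQ z) = 0 := by
      rw [omegaClass, cup_mkQ, hz]
      simp [omegaCocycle]
    have htop : E.coboundaries.mkQ z ∈
        Submodule.span k (Set.range (Sum.elim (omegaClass h) (etaClass h))) := by
      rw [span_omega_eta h]
      trivial
    obtain ⟨g, hg⟩ := (Submodule.mem_span_range_iff_exists_fun k).1 htop
    simp only [Fintype.sum_sum_type, Sum.elim_inl, Sum.elim_inr] at hg
    have hg0 (i) : g (Sum.inr i) = 0 := by
      have := horth i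
      rw [← hg] at this
      simpa [cup_omega_omega, cup_omega_eta, -Fin.sum_univ_two] using this
    rw [← hg]
    simp only [hg0, zero_smul, Finset.sum_const_zero, add_zero]
    exact sum_mem fun i _ => Submodule.smul_mem _ _ (Submodule.subset_span ⟨i, rfl⟩)
  · rw [Submodule.span_le]
    rintro _ ⟨i, rfl⟩
    exact ⟨E.omega i, ⟨omega_mem_ringU h i, omega_mem_ringV h i⟩, omegaCocycle h i, rfl, rfl⟩

theorem W_eq_span (h : E.poly.Separable) {c : Matrix (Fin 2) (Fin 2) k} (hc : c.IsSymm) :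
    E.W c = Submodule.span k (Set.range fun i => E.dRClass (-E.eta c i)) := by
  have e : (fun i => E.dRClass (-E.eta c i)) = -fun i => E.dRClass (E.eta c i) :=
    funext (dRClass_neg_eta h hc)
  have e' : Set.range (-fun i => E.dRClass (E.eta c i)) =
      -Set.range fun i => E.dRClass (E.eta c i) := by
    ext a
    simp [neg_eq_iff_eq_neg]
  rw [e, e', Submodule.span_neg, W]
  congr 1
  ext a
  simp [eq_comm]

theorem W_mem_isotropicComplements (h : E.poly.Separable) {c : Matrix (Fin 2) (Fin 2) k}
    (hc : c.IsSymm) : E.W c ∈ E.isotropicComplements := by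
  have hb := isSymplecticBasis h hc
  rw [W_eq_span h hc]
  refine ⟨?_, fun a ha b hb' => ?_⟩
  · rw [holomorphicClasses_eq_span h]
    simpa only [dRClass_omega h] using hb.isCompl.symm
  · obtain ⟨f, rfl⟩ := (Submodule.mem_span_range_iff_exists_fun k).1 ha
    obtain ⟨g, rfl⟩ := (Submodule.mem_span_range_iff_exists_fun k).1 hb'
    simp [hb.cup_right]

theorem linearIndependent_omegaClass (h : E.poly.Separable) :
    LinearIndependent k (omegaClass h) := by
  have := (linearIndependent_sum.1
    (isSymplecticBasis h (c := 0) Matrix.isSymm_zero).linearIndependent).1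
  simpa [Function.comp_def, dRClass_omega h] using this

/-- If `W^(c) = W^(c')`, then `∑ⱼ (cᵢⱼ - c'ᵢⱼ) [ωⱼ]` is a holomorphic class in `W^(c)`, hence is
zero. -/
theorem W_injOn (h : E.poly.Separable) : Set.InjOn E.W {c | c.IsSymm} := by
  intro c hc c' hc' e
  ext i j
  have hmem : ∑ j, (c i j - c' i j) • omegaClass h j ∈ E.W c := by
    have hd := sub_mem (dRClass_eta_mem_W c i) (e ▸ dRClass_eta_mem_W c' i)
    rw [dRClass_eta h hc, dRClass_eta h hc', add_sub_add_left_eq_sub,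
      ← Finset.sum_sub_distrib] at hd
    simpa only [sub_smul] using hd
  have hhol : ∑ j, (c i j - c' i j) • omegaClass h j ∈ E.holomorphicClasses := by
    rw [holomorphicClasses_eq_span h]
    exact sum_mem fun i _ => Submodule.smul_mem _ _ (Submodule.subset_span ⟨i, rfl⟩)
  have h0 := Submodule.disjoint_def.1 (W_mem_isotropicComplements h hc).1.disjoint _ hmem hhol
  exact sub_eq_zero.1 (Fintype.linearIndependent_iff.1 (linearIndependent_omegaClass h) _ h0 j)

/-- The complement `W` contains a unique vector `[ηᵢ] + ∑ⱼ cᵢⱼ [ωⱼ]` for each `i`; isotropy of `W`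
says that `c` is symmetric, so `W` contains the complement `W^(c)`, hence equals it. -/
theorem W_surjOn (h : E.poly.Separable) :
    Set.SurjOn E.W {c | c.IsSymm} E.isotropicComplements := by
  rintro W ⟨hW, hiso⟩
  have hex (i) : ∃ c : Fin 2 → k, etaClass h i + ∑ j, c j • omegaClass h j ∈ W := by
    have hi : etaClass h i ∈ W ⊔ E.holomorphicClasses := by
      rw [hW.sup_eq_top]
      trivial
    obtain ⟨a, ha, b, hb, hab⟩ := Submodule.mem_sup.1 hi
    rw [holomorphicClasses_eq_span h] at hb
    obtain ⟨g, rfl⟩ := (Submodule.mem_span_range_iff_exists_fun k).1 hb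
    refine ⟨-g, ?_⟩
    rw [← hab]
    simpa [-Fin.sum_univ_two] using ha
  choose c hc using hex
  have hsymm : (Matrix.of c).IsSymm := by
    ext i j
    have := hiso _ (hc i) _ (hc j)
    rw [cup_eta_add] at this
    exact sub_eq_zero.1 this
  refine ⟨Matrix.of c, hsymm, ?_⟩
  have hle : E.W (Matrix.of c) ≤ W := by
    rw [W_eq_span h hsymm, Submodule.span_le]
    rintro _ ⟨i, rfl⟩
    simp only [dRClass_neg_eta h hsymm, dRClass_eta h hsymm]
    exact neg_mem (hc i)
  have hcompl := (W_mem_isotropicComplements h hsymm).1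
  refine eq_of_le_of_inf_le_of_sup_le hle (z := E.holomorphicClasses) ?_ ?_
  · rw [hW.inf_eq_bot]
    exact bot_le
  · rw [hcompl.sup_eq_top]
    exact le_top

theorem W_bijOn (h : E.poly.Separable) :
    Set.BijOn E.W {c | c.IsSymm} E.isotropicComplements :=
  ⟨fun _ hc => W_mem_isotropicComplements h hc, W_injOn h, W_surjOn h⟩

end Symplectic

end QuinticModel

theorem mainTheorem9 (K : Type*) [Field K] [NumberField K]
    (v : IsDedekindDomain.HeightOneSpectrum (NumberField.RingOfIntegers K))
    (E : QuinticModel (NumberField.RingOfIntegers K))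
    (hE : (E.map (algebraMap (NumberField.RingOfIntegers K) K)).poly.Separable) :
    Set.BijOn (E.atPlace v).W
        {c : Matrix (Fin 2) (Fin 2) (v.adicCompletion K) | c.IsSymm}
        (E.atPlace v).isotropicComplements ∧
      ∀ c : Matrix (Fin 2) (Fin 2) (v.adicCompletion K), c.IsSymm →
        (E.atPlace v).IsSymplecticBasis
          (fun i => (E.atPlace v).dRClass ((E.atPlace v).omega i))
          (fun i => (E.atPlace v).dRClass (-(E.atPlace v).eta c i)) := by
  have h : (E.atPlace v).poly.Separable := by
    rw [QuinticModel.map_poly] at hE ⊢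
    rw [IsScalarTower.algebraMap_eq _ K, ← Polynomial.map_map]
    exact hE.map
  exact ⟨QuinticModel.W_bijOn h, fun c hc => QuinticModel.isSymplecticBasis h hc⟩
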